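/- Let $f\in\mathbb{C}[x]=\mathbb{C}[x_1,\dots,x_n]$ be a non-zero polynomial, let $D$ be the $n$-th Weyl algebra over $\mathbb{C}$ (generated by $x_1,\dots,x_n,\partial_1,\dots,\partial_n$), and let $D[s]=D\otimes_{\mathbb{C}}\mathbb{C}[s]$. The free rank-one module $\mathbb{C}[x][s,\tfrac1f]\cdot f^s$ is a left $D[s]$-module via $$\partial_i(g\cdot f^s)=\Big(\frac{\partial g}{\partial x_i}+s\,g\,\frac{\partial f}{\partial x_i}\frac1f\Big)\cdot f^s ,$$ with $\mathbb{C}[x][s]$ acting by multiplication, and $\operatorname{ann}_{D[s]}(f^s)$ is the left ideal of all operators annihilating $f^s$. For $p\in\mathbb{C}^n$ let $D_p$ be the local Weyl algebra at $p$, i.e. the Weyl algebra with coefficients in the localization $\mathbb{C}[x]_p$ of $\mathbb{C}[x]$ at the maximal ideal $\langle x_1-p_1,\dots,x_n-p_n\rangle$; $D_p[s]$ acts on $\mathbb{C}[x]_p[s,\tfrac1f]\cdot f^s$ by the same formula. The local $b$-function $b_{f,p}(s)\in\mathbb{C}[s]$ is the monic polynomial of minimal degree for which there is $P(s)\in D_p[s]$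 with $P(s)f\cdot f^s=b_{f,p}(s)\cdot f^s$. **Proposition 2.10.** Let $P_1(s),\dots,P_k(s)$ generate the left ideal $\operatorname{ann}_{D[s]}(f^s)$, let $\alpha\in\mathbb{C}$, and let $I\subseteq D[s]$ be the left ideal generated by $P_1(s),\dots,P_k(s),f,s+\alpha$. Then for every $p\in\mathbb{C}^n$, $$(s+\alpha)\mid b_{f,p}(s)\iff p\in V(I\cap\mathbb{C}[x]),$$ where $V(J)\subseteq\mathbb{C}^n$ is the set of common zeros of an ideal $J\subseteq\mathbb{C}[x]$. -/

import Mathlib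

open Polynomial

noncomputable section

namespace BSato

/-- A commutative `ℂ`-algebra `A` with `n` pairwise commuting `ℂ`-linear derivations
`∂₁, …, ∂ₙ`.  Only `ℂ[x₁, …, xₙ]` with its partial derivatives, and its localizations, are used. -/
class PartialDerivatives (n : ℕ) (A : Type*) [CommRing A] [Algebra ℂ A] where
  /-- the derivation `∂ᵢ` of `A` -/
  der : Fin n → Derivation ℂ A A
  der_comm : ∀ i j a, der i (der j a) = der j (der i a)

section Localization

variable {A : Type*} [CommRing A] [Algebra ℂ A] (S : Submonoid A)

/-- The ring homomorphism `a ↦ a + ε d(a)` from `A` to the dual numbers over `S⁻¹A`. -/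
def dualHom (d : Derivation ℂ A A) : A →+* TrivSqZeroExt (Localization S) (Localization S) where
  toFun a := TrivSqZeroExt.inl (algebraMap A (Localization S) a) +
    TrivSqZeroExt.inr (algebraMap A (Localization S) (d a))
  map_one' := by ext <;> simp
  map_zero' := by ext <;> simp
  map_add' a b := by
    simp only [map_add, TrivSqZeroExt.inl_add, TrivSqZeroExt.inr_add]
    abel
  map_mul' a b := by
    apply TrivSqZeroExt.ext
    · simp only [TrivSqZeroExt.fst_add, TrivSqZeroExt.fst_mul, TrivSqZeroExt.fst_inl,
        TrivSqZeroExt.fst_inr, map_mul, add_zero]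
    · simp only [TrivSqZeroExt.snd_add, TrivSqZeroExt.fst_add, TrivSqZeroExt.snd_mul,
        TrivSqZeroExt.fst_inl, TrivSqZeroExt.snd_inl, TrivSqZeroExt.fst_inr,
        TrivSqZeroExt.snd_inr, map_mul, map_add, add_zero, zero_add, Derivation.leibniz,
        smul_eq_mul, MulOpposite.smul_eq_mul_unop, MulOpposite.unop_op]
      ring

theorem dualHom_fst (d : Derivation ℂ A A) (a : A) :
    (dualHom S d a).fst = algebraMap A (Localization S) a := by simp [dualHom]

theorem dualHom_snd (d : Derivation ℂ A A) (a : A) :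
    (dualHom S d a).snd = algebraMap A (Localization S) (d a) := by
  change TrivSqZeroExt.snd (TrivSqZeroExt.inl (algebraMap A (Localization S) a) +
    TrivSqZeroExt.inr (algebraMap A (Localization S) (d a))) = _
  rw [TrivSqZeroExt.snd_add, TrivSqZeroExt.snd_inl, TrivSqZeroExt.snd_inr, zero_add]

theorem dualHom_isUnit (d : Derivation ℂ A A) (y : S) : IsUnit (dualHom S d y) := by
  rw [TrivSqZeroExt.isUnit_iff_isUnit_fst, dualHom_fst]
  exact IsLocalization.map_units (Localization S) y

/-- The extension of `dualHom` to `S⁻¹A`, i.e. `g ↦ g + ε d(g)`. -/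
def dualHomLoc (d : Derivation ℂ A A) :
    Localization S →+* TrivSqZeroExt (Localization S) (Localization S) :=
  IsLocalization.lift (M := S) (g := dualHom S d) (dualHom_isUnit S d)

theorem dualHomLoc_algebraMap (d : Derivation ℂ A A) (a : A) :
    dualHomLoc S d (algebraMap A (Localization S) a) = dualHom S d a :=
  IsLocalization.lift_eq _ _

theorem dualHomLoc_fst (d : Derivation ℂ A A) (g : Localization S) :
    (dualHomLoc S d g).fst = g := by
  have h : ((TrivSqZeroExt.fstHom ℂ (Localization S) (Localization S)).toRingHom.comp
      (dualHomLoc S d)) = RingHom.id _ := by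
    apply IsLocalization.ringHom_ext S
    ext a
    simp only [RingHom.comp_apply, dualHomLoc_algebraMap]
    exact dualHom_fst S d a
  exact congrArg (fun φ : Localization S →+* Localization S => φ g) h

/-- The unique extension of a derivation `d` of `A` to the localization `S⁻¹A`
(the quotient rule). -/
def locDer (d : Derivation ℂ A A) : Derivation ℂ (Localization S) (Localization S) :=
  Derivation.mk'
    { toFun := fun g => (dualHomLoc S d g).snd
      map_add' := fun g h => by simp
      map_smul' := fun c g => by
        have hc : dualHomLoc S d (algebraMap ℂ (Localization S) c) =
            TrivSqZeroExt.inl (algebraMap ℂ (Localization S) c) := by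
          rw [IsScalarTower.algebraMap_apply ℂ A (Localization S), dualHomLoc_algebraMap]
          apply TrivSqZeroExt.ext
          · rw [dualHom_fst, TrivSqZeroExt.fst_inl]
          · rw [dualHom_snd, TrivSqZeroExt.snd_inl]
            simp
        rw [Algebra.smul_def, map_mul, hc, TrivSqZeroExt.snd_mul, RingHom.id_apply,
          Algebra.smul_def c]
        simp only [TrivSqZeroExt.fst_inl, TrivSqZeroExt.snd_inl, smul_eq_mul, smul_zero,
          add_zero] }
    (fun g h => by simp [dualHomLoc_fst, TrivSqZeroExt.snd_mul, mul_comm])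

theorem locDer_algebraMap (d : Derivation ℂ A A) (a : A) :
    locDer S d (algebraMap A (Localization S) a) = algebraMap A (Localization S) (d a) := by
  change (dualHomLoc S d (algebraMap A (Localization S) a)).snd = _
  rw [dualHomLoc_algebraMap, dualHom_snd]

theorem der_ext_loc (d₁ d₂ : Derivation ℂ (Localization S) (Localization S))
    (h : ∀ a : A, d₁ (algebraMap A _ a) = d₂ (algebraMap A _ a)) : d₁ = d₂ := by
  ext g
  obtain ⟨⟨a, y⟩, hg⟩ := IsLocalization.surj S g
  have hu := IsLocalization.map_units (Localization S) y
  have e₁ := congrArg d₁ hg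
  have e₂ := congrArg d₂ hg
  simp only [Derivation.leibniz, smul_eq_mul] at e₁ e₂
  apply hu.mul_left_cancel
  rw [h, h] at e₁
  linear_combination e₁ - e₂

/-- Every localization of `A` inherits the derivations of `A`. -/
instance (n : ℕ) [PartialDerivatives n A] : PartialDerivatives n (Localization S) where
  der i := locDer S (PartialDerivatives.der i)
  der_comm i j g := by
    have h : ⁅locDer S (PartialDerivatives.der (n := n) i),
        locDer S (PartialDerivatives.der (n := n) j)⁆ = 0 := by
      apply der_ext_loc
      intro a
      simp [Derivation.commutator_apply, locDer_algebraMap,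
        PartialDerivatives.der_comm (n := n) (A := A) i j a]
    have := congrArg (fun D : Derivation ℂ (Localization S) (Localization S) => D g) h
    simpa [Derivation.commutator_apply, sub_eq_zero] using this

end Localization

/-- The polynomial ring `ℂ[x₁, …, xₙ]` with its partial derivatives. -/
instance (n : ℕ) : PartialDerivatives n (MvPolynomial (Fin n) ℂ) where
  der i := MvPolynomial.pderiv i
  der_comm i j a := by
    have h : ⁅(MvPolynomial.pderiv i :
          Derivation ℂ (MvPolynomial (Fin n) ℂ) (MvPolynomial (Fin n) ℂ)),
        (MvPolynomial.pderiv j :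
          Derivation ℂ (MvPolynomial (Fin n) ℂ) (MvPolynomial (Fin n) ℂ))⁆ = 0 := by
      refine MvPolynomial.derivation_ext (R := ℂ) (σ := Fin n) ?_
      intro k
      classical
      simp only [Derivation.commutator_apply, MvPolynomial.pderiv_X, Derivation.coe_zero,
        Pi.zero_apply, Pi.single_apply]
      split_ifs <;> simp
    have := congrArg (fun D : Derivation ℂ (MvPolynomial (Fin n) ℂ)
      (MvPolynomial (Fin n) ℂ) => D a) h
    simpa [Derivation.commutator_apply, sub_eq_zero] using this

section Weyl

variable (n : ℕ) (A : Type*) [CommRing A] [Algebra ℂ A] [PartialDerivatives n A]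

/-- The defining relations of the Weyl algebra with coefficients in `A`, on the free algebra with
one generator for each `a ∈ A` and generators `∂₁, …, ∂ₙ`: the generators from `A` add, multiply
and scale as in `A`, `∂ᵢ a = a ∂ᵢ + ∂ᵢ(a)`, and `∂ᵢ ∂ⱼ = ∂ⱼ ∂ᵢ`. -/
inductive WeylRel : FreeAlgebra ℂ (A ⊕ Fin n) → FreeAlgebra ℂ (A ⊕ Fin n) → Prop
  | add (a b : A) : WeylRel (FreeAlgebra.ι ℂ (Sum.inl (a + b)))
      (FreeAlgebra.ι ℂ (Sum.inl a) + FreeAlgebra.ι ℂ (Sum.inl b))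
  | mul (a b : A) : WeylRel (FreeAlgebra.ι ℂ (Sum.inl (a * b)))
      (FreeAlgebra.ι ℂ (Sum.inl a) * FreeAlgebra.ι ℂ (Sum.inl b))
  | scalar (c : ℂ) : WeylRel (FreeAlgebra.ι ℂ (Sum.inl (algebraMap ℂ A c)))
      (algebraMap ℂ (FreeAlgebra ℂ (A ⊕ Fin n)) c)
  | leibniz (i : Fin n) (a : A) :
      WeylRel (FreeAlgebra.ι ℂ (Sum.inr i) * FreeAlgebra.ι ℂ (Sum.inl a))
        (FreeAlgebra.ι ℂ (Sum.inl a) * FreeAlgebra.ι ℂ (Sum.inr i) +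
          FreeAlgebra.ι ℂ (Sum.inl (PartialDerivatives.der i a)))
  | comm (i j : Fin n) :
      WeylRel (FreeAlgebra.ι ℂ (Sum.inr i) * FreeAlgebra.ι ℂ (Sum.inr j))
        (FreeAlgebra.ι ℂ (Sum.inr j) * FreeAlgebra.ι ℂ (Sum.inr i))

/-- The Weyl algebra with coefficients in `A`.  For `A = ℂ[x₁, …, xₙ]` this is the `n`-th Weyl
algebra `D`; for `A = ℂ[x₁, …, xₙ]_𝔪` it is the local Weyl algebra. -/
def WeylAlgebra : Type _ := RingQuot (WeylRel n A)

instance : Ring (WeylAlgebra n A) := inferInstanceAs (Ring (RingQuot (WeylRel n A)))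

instance : Algebra ℂ (WeylAlgebra n A) :=
  inferInstanceAs (Algebra ℂ (RingQuot (WeylRel n A)))

namespace WeylAlgebra

/-- The quotient map from the free algebra. -/
def mk : FreeAlgebra ℂ (A ⊕ Fin n) →ₐ[ℂ] WeylAlgebra n A := RingQuot.mkAlgHom ℂ (WeylRel n A)

variable {n A} in
theorem mk_rel {x y : FreeAlgebra ℂ (A ⊕ Fin n)} (h : WeylRel n A x y) :
    mk n A x = mk n A y := RingQuot.mkAlgHom_rel ℂ h

/-- The embedding of the coefficient ring: `a ∈ A` as an operator of order zero. -/
def coeff : A →+* WeylAlgebra n A where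
  toFun a := mk n A (FreeAlgebra.ι ℂ (Sum.inl a))
  map_one' := by
    have h := mk_rel (WeylRel.scalar (n := n) (A := A) 1)
    rwa [map_one, map_one, map_one] at h
  map_zero' := by
    have h := mk_rel (WeylRel.scalar (n := n) (A := A) 0)
    rwa [map_zero, map_zero, map_zero] at h
  map_add' a b := by rw [mk_rel (WeylRel.add a b), map_add]
  map_mul' a b := by rw [mk_rel (WeylRel.mul a b), map_mul]

/-- The operator `∂ᵢ`. -/
def partialOp (i : Fin n) : WeylAlgebra n A := mk n A (FreeAlgebra.ι ℂ (Sum.inr i))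

end WeylAlgebra

variable {A}
variable (f : A)

/-- `∂ᵢ` on `A[1/f][s]`, applied to the coefficients of the powers of `s`. -/
def coeffDer (i : Fin n) : Derivation ℂ (Localization.Away f)[X] (Localization.Away f)[X] :=
  PolynomialModule.equivPolynomialSelf.toLinearMap.compDer
    (PartialDerivatives.der (n := n) (A := Localization.Away f) i).mapCoeffs

theorem coeffDer_coeff (i : Fin n) (g : (Localization.Away f)[X]) (k : ℕ) :
    (coeffDer n f i g).coeff k = PartialDerivatives.der i (g.coeff k) := rfl

theorem coeffDer_C (i : Fin n) (a : Localization.Away f) :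
    coeffDer n f i (C a) = C (PartialDerivatives.der i a) := by
  ext k
  rw [coeffDer_coeff, coeff_C, coeff_C]
  split_ifs <;> simp

theorem coeffDer_X (i : Fin n) : coeffDer n f i X = 0 := by
  ext k
  rw [coeffDer_coeff, coeff_X]
  split_ifs <;> simp

/-- The logarithmic derivative `(∂ᵢ f) / f ∈ A[1/f]`. -/
def logDer (i : Fin n) : Localization.Away f :=
  algebraMap A _ (PartialDerivatives.der i f) * IsLocalization.Away.invSelf f

theorem der_algebraMap (i : Fin n) (a : A) :
    PartialDerivatives.der i (algebraMap A (Localization.Away f) a) =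
      algebraMap A (Localization.Away f) (PartialDerivatives.der i a) :=
  locDer_algebraMap _ _ _

theorem algebraMap_mul_logDer (i : Fin n) :
    algebraMap A (Localization.Away f) f * logDer n f i =
      algebraMap A _ (PartialDerivatives.der i f) := by
  have h : algebraMap A (Localization.Away f) f * IsLocalization.Away.invSelf f = 1 :=
    IsLocalization.Away.mul_invSelf f
  rw [logDer]
  linear_combination (algebraMap A (Localization.Away f) (PartialDerivatives.der i f)) * h

theorem der_logDer_comm (i j : Fin n) :
    PartialDerivatives.der i (logDer n f j) = PartialDerivatives.der j (logDer n f i) := by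
  have hu : IsUnit (algebraMap A (Localization.Away f) f) :=
    IsLocalization.Away.algebraMap_isUnit f
  have hi := algebraMap_mul_logDer n f i
  have hj := algebraMap_mul_logDer n f j
  have e₁ := congrArg (PartialDerivatives.der (n := n) i) hj
  have e₂ := congrArg (PartialDerivatives.der (n := n) j) hi
  simp only [Derivation.leibniz, smul_eq_mul, der_algebraMap] at e₁ e₂
  rw [PartialDerivatives.der_comm i j, ← hi] at e₁
  rw [← hj] at e₂
  apply hu.mul_left_cancel
  linear_combination e₁ - e₂

/-- The operator `g ↦ ∂g/∂xᵢ + s g (∂f/∂xᵢ)(1/f)` on `A[1/f][s]`. -/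
def twistedDer (i : Fin n) : Module.End ℂ (Localization.Away f)[X] :=
  (coeffDer n f i : (Localization.Away f)[X] →ₗ[ℂ] (Localization.Away f)[X]) +
    LinearMap.mulLeft ℂ (X * C (logDer n f i))

theorem twistedDer_apply (i : Fin n) (g : (Localization.Away f)[X]) :
    twistedDer n f i g = coeffDer n f i g + X * C (logDer n f i) * g := rfl

/-- The action of the generators of the Weyl algebra on `A[1/f][s] · f^s`. -/
def generatorAction : A ⊕ Fin n → Module.End ℂ (Localization.Away f)[X]
  | Sum.inl a => LinearMap.mulLeft ℂ (C (algebraMap A (Localization.Away f) a))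
  | Sum.inr i => twistedDer n f i

theorem generatorAction_rel {x y : FreeAlgebra ℂ (A ⊕ Fin n)} (h : WeylRel n A x y) :
    FreeAlgebra.lift ℂ (generatorAction n f) x = FreeAlgebra.lift ℂ (generatorAction n f) y := by
  induction h with
  | add a b => ext1 g; simp [generatorAction, add_mul]
  | mul a b => ext1 g; simp [generatorAction]
  | scalar c =>
    ext1 g
    simp only [FreeAlgebra.lift_ι_apply, generatorAction, AlgHom.commutes,
      Module.algebraMap_end_apply, LinearMap.mulLeft_apply, ← IsScalarTower.algebraMap_apply]
    rw [Algebra.smul_def]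
    rfl
  | leibniz i a =>
    ext1 g
    simp only [map_mul, map_add, FreeAlgebra.lift_ι_apply, generatorAction, Module.End.mul_apply,
      LinearMap.add_apply, LinearMap.mulLeft_apply, twistedDer_apply, Derivation.leibniz,
      smul_eq_mul, coeffDer_C, der_algebraMap]
    ring
  | comm i j =>
    ext1 g
    have h₁ : coeffDer n f i (coeffDer n f j g) = coeffDer n f j (coeffDer n f i g) := by
      ext k
      simp only [coeffDer_coeff]
      exact PartialDerivatives.der_comm i j _
    simp only [map_mul, map_add, FreeAlgebra.lift_ι_apply, generatorAction, Module.End.mul_apply,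
      twistedDer_apply, Derivation.leibniz, smul_eq_mul, coeffDer_C, coeffDer_X, h₁,
      der_logDer_comm n f i j]
    ring

/-- The action of the Weyl algebra on `A[1/f][s] · f^s`. -/
def weylAction : WeylAlgebra n A →ₐ[ℂ] Module.End ℂ (Localization.Away f)[X] :=
  RingQuot.liftAlgHom ℂ ⟨FreeAlgebra.lift ℂ (generatorAction n f),
    fun _ _ h => generatorAction_rel n f h⟩

theorem weylAction_mk (x : FreeAlgebra ℂ (A ⊕ Fin n)) :
    weylAction n f (WeylAlgebra.mk n A x) = FreeAlgebra.lift ℂ (generatorAction n f) x :=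
  RingQuot.liftAlgHom_mkAlgHom_apply _ _ _ _

theorem weylAction_commute (P : WeylAlgebra n A) :
    Commute (weylAction n f P) (LinearMap.mulLeft ℂ (X : (Localization.Away f)[X])) := by
  obtain ⟨x, rfl⟩ : ∃ x, WeylAlgebra.mk n A x = P :=
    RingQuot.mkAlgHom_surjective ℂ (WeylRel n A) P
  rw [weylAction_mk]
  induction x using FreeAlgebra.induction with
  | grade0 c =>
    rw [AlgHom.commutes]
    exact Algebra.commutes _ _
  | grade1 z =>
    rw [FreeAlgebra.lift_ι_apply]
    rcases z with a | i
    · ext1 g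
      simp only [generatorAction, Module.End.mul_apply, LinearMap.mulLeft_apply]
      ring
    · ext1 g
      simp only [generatorAction, Module.End.mul_apply, LinearMap.mulLeft_apply,
        twistedDer_apply, Derivation.leibniz, smul_eq_mul, coeffDer_X]
      ring
  | mul x y hx hy => rw [map_mul]; exact hx.mul_left hy
  | add x y hx hy => rw [map_add]; exact hx.add_left hy

/-- The action of `D[s]` on `A[1/f][s] · f^s`: `s` acts as multiplication by `s`. -/
def weylPolyAction : (WeylAlgebra n A)[X] →+* Module.End ℂ (Localization.Away f)[X] :=
  eval₂RingHom' (weylAction n f).toRingHom (LinearMap.mulLeft ℂ X) (weylAction_commute n f)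

/-- The module `A[s, 1/f] · f^s`, free of rank one over `A[s, 1/f]` on the formal symbol `f^s`;
the element `g · f^s` is represented by `g`. -/
@[nolint unusedArguments]
def PowerModule (_n : ℕ) (f : A) : Type _ := (Localization.Away f)[X]

instance : AddCommGroup (PowerModule n f) :=
  inferInstanceAs (AddCommGroup (Localization.Away f)[X])

instance : Module (Localization.Away f)[X] (PowerModule n f) :=
  inferInstanceAs (Module (Localization.Away f)[X] (Localization.Away f)[X])

instance : Module ℂ (PowerModule n f) := inferInstanceAs (Module ℂ (Localization.Away f)[X])

/-- The left `D[s]`-module structure on `A[s, 1/f] · f^s`. -/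
instance : Module (WeylAlgebra n A)[X] (PowerModule n f) :=
  Module.compHom (Localization.Away f)[X] (weylPolyAction n f)

/-- The formal symbol `f^s`. -/
def fPow : PowerModule n f := (1 : (Localization.Away f)[X])

/-- The action of `∂ᵢ`: `∂ᵢ (g · f^s) = (∂g/∂xᵢ + s g (∂f/∂xᵢ)(1/f)) · f^s`. -/
theorem partialOp_smul (i : Fin n) (g : (Localization.Away f)[X]) :
    (C (WeylAlgebra.partialOp n A i) : (WeylAlgebra n A)[X]) • (g • fPow n f) =
      (coeffDer n f i g + X * g * C (logDer n f i)) • fPow n f := by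
  change eval₂ (weylAction n f).toRingHom _ (C _) (g * 1) =
    (coeffDer n f i g + X * g * C (logDer n f i)) * (1 : (Localization.Away f)[X])
  rw [eval₂_C]
  change weylAction n f (WeylAlgebra.mk n A _) (g * 1) = _
  rw [weylAction_mk, FreeAlgebra.lift_ι_apply, mul_one, mul_one]
  change twistedDer n f i g = _
  rw [twistedDer_apply]
  ring

/-- The coefficient ring acts by multiplication. -/
theorem coeff_smul (a : A) (g : (Localization.Away f)[X]) :
    (C (WeylAlgebra.coeff n A a) : (WeylAlgebra n A)[X]) • (g • fPow n f) =
      (C (algebraMap A _ a) * g) • fPow n f := by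
  change eval₂ (weylAction n f).toRingHom _ (C _) (g * 1) = (_ * 1 : (Localization.Away f)[X])
  rw [eval₂_C]
  change weylAction n f (WeylAlgebra.mk n A _) (g * 1) = _
  rw [weylAction_mk, FreeAlgebra.lift_ι_apply, mul_one, mul_one]
  rfl

/-- The variable `s` acts by multiplication. -/
theorem s_smul (g : (Localization.Away f)[X]) :
    (X : (WeylAlgebra n A)[X]) • (g • fPow n f) = (X * g) • fPow n f := by
  change eval₂ (weylAction n f).toRingHom _ X (g * 1) = (_ * 1 : (Localization.Away f)[X])
  rw [eval₂_X, mul_one, mul_one]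
  rfl

/-- The left ideal of `D[s]` of all operators annihilating `f^s`. -/
def annFPow : Ideal (WeylAlgebra n A)[X] :=
  Ideal.torsionOf (WeylAlgebra n A)[X] (PowerModule n f) (fPow n f)

/-- The functional equation: there is `P(s) ∈ D[s]` with `P(s) f · f^s = b(s) · f^s`. -/
def FunctionalEquation (b : ℂ[X]) : Prop :=
  ∃ P : (WeylAlgebra n A)[X],
    (P * C (WeylAlgebra.coeff n A f)) • fPow n f =
      (b.map (algebraMap ℂ (WeylAlgebra n A))) • fPow n f

end Weyl

section Local

variable {n : ℕ}

/-- The maximal ideal `𝔪_p = ⟨x₁ - p₁, …, xₙ - pₙ⟩` of `ℂ[x₁, …, xₙ]`. -/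
def maxIdeal (p : Fin n → ℂ) : Ideal (MvPolynomial (Fin n) ℂ) :=
  Ideal.span (Set.range fun i => MvPolynomial.X i - MvPolynomial.C (p i))

theorem maxIdeal_eq_ker (p : Fin n → ℂ) : maxIdeal p = RingHom.ker (MvPolynomial.eval p) := by
  apply le_antisymm
  · rw [maxIdeal, Ideal.span_le]
    rintro _ ⟨i, rfl⟩
    simp
  · intro g hg
    have key : ∀ g : MvPolynomial (Fin n) ℂ,
        g - MvPolynomial.C (MvPolynomial.eval p g) ∈ maxIdeal p := by
      intro g
      induction g using MvPolynomial.induction_on with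
      | C a => simp
      | add g h hg hh =>
        have := (maxIdeal p).add_mem hg hh
        convert this using 1
        simp only [map_add]
        ring
      | mul_X g i hg =>
        have h₁ := (maxIdeal p).mul_mem_left (MvPolynomial.X i) hg
        have h₂ : MvPolynomial.X i - MvPolynomial.C (p i) ∈ maxIdeal p :=
          Ideal.subset_span ⟨i, rfl⟩
        have h₃ := (maxIdeal p).mul_mem_left (MvPolynomial.C (MvPolynomial.eval p g)) h₂
        convert (maxIdeal p).add_mem h₁ h₃ using 1
        simp only [map_mul, MvPolynomial.eval_X]
        ring
    have h := key g
    rwa [RingHom.mem_ker.mp hg, map_zero, sub_zero] at h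

instance (p : Fin n → ℂ) : (maxIdeal p).IsPrime := by
  rw [maxIdeal_eq_ker]
  exact RingHom.ker_isPrime _

/-- The local ring `ℂ[x₁, …, xₙ]_p`. -/
abbrev LocalRing (p : Fin n → ℂ) : Type := Localization.AtPrime (maxIdeal p)

/-- `b` is a monic polynomial of minimal degree such that `P(s) f · f^s = b(s) · f^s` for some
`P(s) ∈ D_p[s]`, where `D_p` is the local Weyl algebra at `p`. -/
def IsLocalBFunction (f : MvPolynomial (Fin n) ℂ) (p : Fin n → ℂ) (b : ℂ[X]) : Prop :=
  (b.Monic ∧ FunctionalEquation n (algebraMap _ (LocalRing p) f) b) ∧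
    ∀ c : ℂ[X], c.Monic → FunctionalEquation n (algebraMap _ (LocalRing p) f) c →
      b.natDegree ≤ c.natDegree

open Classical in
/-- The local `b`-function `b_{f,p}(s)` of `f` at the point `p`. For `f ≠ 0` it exists by
Bernstein's theorem and is unique (the value `0` is a placeholder for non-existence). -/
def localBFunction (f : MvPolynomial (Fin n) ℂ) (p : Fin n → ℂ) : ℂ[X] :=
  if h : ∃ b, IsLocalBFunction f p b then h.choose else 0

end Local

end BSato

end

/-! The divisibility criterion is Bézout together with localization. If `s + α` does not divide `b =
b_{f,p}`, write `v (s + α) + u b = 1` and apply this to `f^s`. Since `b f^s = P f·f^s` with `P` over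
the local ring, clearing the denominators of `u P` by some `h` with `h(p) ≠ 0` puts `h` in `ann(f^s)
+ D[s] f + D[s] (s + α)`. Conversely, let such an `h` exist and let `b = (s + α) c`. Multiplying the
relation for `h` by `c / h` turns `c (s + α) f^s = b f^s` into an element of `D_p[s] f·f^s`, so `c`
satisfies the functional equation in smaller degree, against minimality. This is `not_dvd_iff`, and
`coeff_mem_span_iff` translates it into ideal membership.

The argument needs `b_{f,p}` to exist, so most of the file proves Bernstein's theorem
(`exists_functionalEquation`). Over `ℂ(s)`, the module `ℂ[x][1/f] f^s` has a filtration of dimension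
`O(j^n)`. By Bernstein's inequality (`pow_le_finrank_mul_finrank`), every nonzero subquotient grows
at least like `j^n`, with a uniform constant, so a strictly descending chain of submodules has
bounded length (`exists_mem_succ_of_growth`). Applied to the chain `D[s] f^m f^s`, this gives `b(s)
f^m f^s ∈ D[s] f^(m+1) f^s` with `b ≠ 0`, and the substitution `s ↦ s - m` reduces to `m = 0`. A
global functional equation localizes to every `p`. -/

noncomputable section

namespace BSato

/-! ### Normally ordered operators and Bernstein's inequality -/

section Symbols

/-- Evaluation of a polynomial at a commuting family of elements of a (noncommutative) algebra. -/
def evalCommuting {K A τ : Type*} [CommRing K] [Ring A] [Algebra K A] (T : τ → A)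
    (hT : ∀ i j, T i * T j = T j * T i) : MvPolynomial τ K →ₐ[K] A :=
  -- `MvPolynomial.aeval` needs a commutative target, so the evaluation takes place in the
  -- subalgebra generated by the `T i`.
  haveI : IsMulCommutative (Algebra.adjoin K (Set.range T)) :=
    Algebra.isMulCommutative_adjoin K (by
      rintro _ ⟨i, rfl⟩ _ ⟨j, rfl⟩
      exact hT i j)
  letI : CommRing (Algebra.adjoin K (Set.range T)) :=
    { (Algebra.adjoin K (Set.range T)).toRing with
      mul_comm := IsMulCommutative.is_comm.comm }
  (Algebra.adjoin K (Set.range T)).val.comp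
    (MvPolynomial.aeval fun i => ⟨T i, Algebra.subset_adjoin ⟨i, rfl⟩⟩)

theorem evalCommuting_X {K A τ : Type*} [CommRing K] [Ring A] [Algebra K A] (T : τ → A)
    (hT : ∀ i j, T i * T j = T j * T i) (i : τ) :
    evalCommuting (K := K) T hT (MvPolynomial.X i) = T i := by
  simp [evalCommuting]

variable {K V : Type*} [Field K] [AddCommGroup V] [Module K V] {n : ℕ}

/-- The operators `X₁, …, Xₙ, D₁, …, Dₙ` satisfy the relations of the Weyl algebra. -/
structure IsWeylFamily (X D : Fin n → Module.End K V) : Prop where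
  X_comm : ∀ i j, X i * X j = X j * X i
  D_comm : ∀ i j, D i * D j = D j * D i
  D_X : ∀ i j, D i * X j = X j * D i + if i = j then 1 else 0

variable {X D : Fin n → Module.End K V}

/-- Multiplication of operators by `Xᵢ` on the left and by `Dᵢ` on the right. -/
def normalMul (X D : Fin n → Module.End K V) : Fin n ⊕ Fin n → Module.End K (Module.End K V)
  | Sum.inl i => LinearMap.mulLeft K (X i)
  | Sum.inr i => LinearMap.mulRight K (D i)

/-- Left multiplications commute with right multiplications, so the relation between `D i` and `X i`
is never needed. This is what lets a commutative polynomial encode a normally ordered operator. -/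
theorem normalMul_comm (h : IsWeylFamily X D) (a b : Fin n ⊕ Fin n) :
    normalMul X D a * normalMul X D b = normalMul X D b * normalMul X D a := by
  ext1 P
  rcases a with i | i <;> rcases b with j | j <;>
    simp only [normalMul, Module.End.mul_apply, LinearMap.mulLeft_apply, LinearMap.mulRight_apply]
  · rw [← mul_assoc, h.X_comm, mul_assoc]
  · rw [mul_assoc]
  · rw [mul_assoc]
  · rw [mul_assoc, h.D_comm, mul_assoc]

/-- The normally ordered operator with a given symbol. -/
def ofSymbol (h : IsWeylFamily X D) :
    MvPolynomial (Fin n ⊕ Fin n) K →ₗ[K] Module.End K V :=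
  LinearMap.applyₗ (1 : Module.End K V) ∘ₗ
    (evalCommuting (normalMul X D) (normalMul_comm h)).toLinearMap

theorem ofSymbol_C (h : IsWeylFamily X D) (c : K) :
    ofSymbol h (MvPolynomial.C c) = c • 1 := by
  have : (MvPolynomial.C c : MvPolynomial (Fin n ⊕ Fin n) K) = algebraMap K _ c := rfl
  simp [ofSymbol, this]

theorem ofSymbol_mul_X (h : IsWeylFamily X D) (p : MvPolynomial (Fin n ⊕ Fin n) K)
    (a : Fin n ⊕ Fin n) :
    ofSymbol h (p * MvPolynomial.X a) = normalMul X D a (ofSymbol h p) := by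
  rw [mul_comm]
  simp [ofSymbol, evalCommuting_X]

theorem ofSymbol_mul_X_inl (h : IsWeylFamily X D) (p : MvPolynomial (Fin n ⊕ Fin n) K)
    (i : Fin n) :
    ofSymbol h (p * MvPolynomial.X (Sum.inl i)) = X i * ofSymbol h p :=
  ofSymbol_mul_X h p _

theorem ofSymbol_mul_X_inr (h : IsWeylFamily X D) (p : MvPolynomial (Fin n ⊕ Fin n) K)
    (i : Fin n) :
    ofSymbol h (p * MvPolynomial.X (Sum.inr i)) = ofSymbol h p * D i :=
  ofSymbol_mul_X h p _

/-- Commutation with `D j` is a derivation sending `X j` to `1` and killing the other generators,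
hence it differentiates the symbol. With `ofSymbol_mul_Xop`, its counterpart for `X j`, it gives
commutators whose symbols have lower degree. -/
theorem D_mul_ofSymbol (h : IsWeylFamily X D) (j : Fin n)
    (p : MvPolynomial (Fin n ⊕ Fin n) K) :
    D j * ofSymbol h p =
      ofSymbol h p * D j + ofSymbol h (MvPolynomial.pderiv (Sum.inl j) p) := by
  induction p using MvPolynomial.induction_on with
  | C c => simp [ofSymbol_C]
  | add p q hp hq => simp only [map_add, mul_add, add_mul, hp, hq]; abel
  | mul_X p a hp =>
    classical
    rw [MvPolynomial.pderiv_mul, map_add, MvPolynomial.pderiv_X]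
    rcases a with i | i
    · rw [ofSymbol_mul_X_inl, ofSymbol_mul_X_inl, ← mul_assoc, h.D_X, add_mul, mul_assoc, hp,
        mul_add, mul_assoc]
      by_cases hij : j = i
      · subst hij; simp; abel
      · simp [hij, Ne.symm hij]
    · rw [ofSymbol_mul_X_inr, ofSymbol_mul_X_inr, ← mul_assoc, hp]
      simp [add_mul, mul_assoc, h.D_comm]

theorem ofSymbol_mul_Xop (h : IsWeylFamily X D) (j : Fin n)
    (p : MvPolynomial (Fin n ⊕ Fin n) K) :
    ofSymbol h p * X j =
      X j * ofSymbol h p + ofSymbol h (MvPolynomial.pderiv (Sum.inr j) p) := by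
  induction p using MvPolynomial.induction_on with
  | C c => simp [ofSymbol_C]
  | add p q hp hq => simp only [map_add, mul_add, add_mul, hp, hq]; abel
  | mul_X p a hp =>
    classical
    rw [MvPolynomial.pderiv_mul, map_add, MvPolynomial.pderiv_X]
    rcases a with i | i
    · rw [ofSymbol_mul_X_inl, ofSymbol_mul_X_inl, mul_assoc, hp]
      simp [mul_add, ← mul_assoc, h.X_comm]
    · rw [ofSymbol_mul_X_inr, ofSymbol_mul_X_inr, mul_assoc, h.D_X, mul_add, ← mul_assoc, hp,
        add_mul, mul_assoc]
      by_cases hij : i = j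
      · subst hij; simp; abel
      · simp [hij]

/-- A filtration shifted by at most one by all operators `Xᵢ`, `Dᵢ`. -/
structure IsGoodFiltration (X D : Fin n → Module.End K V) (G : ℕ → Submodule K V) : Prop where
  mono : Monotone G
  X_mem : ∀ i j, ∀ v ∈ G j, X i v ∈ G (j + 1)
  D_mem : ∀ i j, ∀ v ∈ G j, D i v ∈ G (j + 1)

theorem ofSymbol_monomial_mem (h : IsWeylFamily X D) {G : ℕ → Submodule K V}
    (hG : IsGoodFiltration X D G) (m : Fin n ⊕ Fin n →₀ ℕ) (c : K) :
    ∀ j, ∀ v ∈ G j, ofSymbol h (MvPolynomial.monomial m c) v ∈ G (j + m.degree) := by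
  induction hk : m.degree generalizing m with
  | zero =>
    intro j v hv
    rw [Finsupp.degree_eq_zero_iff] at hk
    subst hk
    have := ofSymbol_C h c
    rw [MvPolynomial.C_apply] at this
    rw [this]
    exact (G j).smul_mem c hv
  | succ k ih =>
    intro j v hv
    have hm : m ≠ 0 := by
      rintro rfl
      simp at hk
    obtain ⟨a, ha⟩ := Finsupp.ne_iff.mp hm
    obtain ⟨m', rfl⟩ : ∃ m', m = m' + Finsupp.single a 1 := by
      refine ⟨m - Finsupp.single a 1, (tsub_add_cancel_of_le ?_).symm⟩
      rw [Finsupp.single_le_iff]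
      exact Nat.one_le_iff_ne_zero.mpr ha
    have hk' : m'.degree = k := by simpa using hk
    have e : MvPolynomial.monomial (m' + Finsupp.single a 1) c =
        MvPolynomial.monomial m' c * MvPolynomial.X a := by
      rw [MvPolynomial.X, MvPolynomial.monomial_mul, mul_one]
    rw [e]
    rcases a with i | i
    · rw [ofSymbol_mul_X_inl]
      exact hG.X_mem _ _ _ (ih m' hk' j v hv)
    · rw [ofSymbol_mul_X_inr]
      -- A factor `D i` is appended on the right and therefore acts on `v` first, so the induction
      -- hypothesis starts one step higher.
      have := ih m' hk' (j + 1) _ (hG.D_mem i _ _ hv)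
      rwa [add_assoc, add_comm 1 k] at this

theorem ofSymbol_mem (h : IsWeylFamily X D) {G : ℕ → Submodule K V}
    (hG : IsGoodFiltration X D G) (p : MvPolynomial (Fin n ⊕ Fin n) K) (d : ℕ)
    (hp : p.totalDegree ≤ d) (j : ℕ) (v : V) (hv : v ∈ G j) : ofSymbol h p v ∈ G (j + d) := by
  rw [p.as_sum, map_sum, LinearMap.sum_apply]
  refine Submodule.sum_mem _ fun m hm => ?_
  refine hG.mono ?_ (ofSymbol_monomial_mem h hG m _ j v hv)
  have := MvPolynomial.le_totalDegree hm
  change m.degree ≤ _ at this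
  omega

/-- An operator killing `G (d + 1)` has commutators with `X i` and `D i` that kill `G d`. By
induction all partial derivatives of the symbol vanish, so in characteristic zero the symbol is a
constant, and that constant kills `v ≠ 0`. -/
theorem eq_zero_of_ofSymbol_eq_zero [CharZero K] (h : IsWeylFamily X D) {G : ℕ → Submodule K V}
    (hG : IsGoodFiltration X D G) {v : V} (hv0 : v ≠ 0) (hv : v ∈ G 0) (d : ℕ) :
    ∀ p : MvPolynomial (Fin n ⊕ Fin n) K, p.totalDegree ≤ d →
      (∀ w ∈ G d, ofSymbol h p w = 0) → p = 0 := by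
  have key : ∀ p : MvPolynomial (Fin n ⊕ Fin n) K, p.totalDegree = 0 → ofSymbol h p v = 0 →
      p = 0 := by
    intro p hp hpv
    rw [MvPolynomial.totalDegree_eq_zero_iff_eq_C] at hp
    rw [hp, ofSymbol_C] at hpv
    have : MvPolynomial.coeff 0 p = 0 := by simpa [hv0] using hpv
    rw [hp, this, map_zero]
  induction d with
  | zero => exact fun p hp hpw => key p (by omega) (hpw v hv)
  | succ d ih =>
    intro p hp hpw
    have hder : ∀ a, MvPolynomial.pderiv a p = 0 := by
      intro a
      apply ih
      · refine Finset.sup_le fun m hm => ?_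
        rw [MvPolynomial.mem_support_iff, MvPolynomial.coeff_pderiv] at hm
        have := MvPolynomial.le_totalDegree
          (MvPolynomial.mem_support_iff.mpr (left_ne_zero_of_mul hm))
        change (m + Finsupp.single a 1).degree ≤ _ at this
        rw [map_add, Finsupp.degree_single] at this
        change m.degree ≤ d
        omega
      · intro w hw
        have hw' := hG.mono (Nat.le_succ d) hw
        rcases a with i | i
        · have e := congrArg (fun P : Module.End K V => P w) (D_mul_ofSymbol h i p)
          simp only [Module.End.mul_apply, LinearMap.add_apply, hpw w hw',
            hpw _ (hG.D_mem i _ _ hw), map_zero, zero_add] at e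
          exact e.symm
        · have e := congrArg (fun P : Module.End K V => P w) (ofSymbol_mul_Xop h i p)
          simp only [Module.End.mul_apply, LinearMap.add_apply, hpw w hw',
            hpw _ (hG.X_mem i _ _ hw), map_zero, zero_add] at e
          exact e.symm
    refine key p ?_ (hpw v (hG.mono (Nat.zero_le _) hv))
    rw [MvPolynomial.totalDegree_eq_zero_iff]
    intro m hm a
    by_contra hma
    obtain ⟨m', rfl⟩ : ∃ m', m = m' + Finsupp.single a 1 := by
      refine ⟨m - Finsupp.single a 1, (tsub_add_cancel_of_le ?_).symm⟩
      rw [Finsupp.single_le_iff]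
      exact Nat.one_le_iff_ne_zero.mpr hma
    have e := congrArg (MvPolynomial.coeff m') (hder a)
    rw [MvPolynomial.coeff_pderiv, MvPolynomial.coeff_zero] at e
    rw [MvPolynomial.mem_support_iff] at hm
    have : ((m' a : K) + 1) ≠ 0 := by exact_mod_cast Nat.succ_ne_zero (m' a)
    exact (mul_ne_zero hm this) e

/-- Bernstein's inequality in the form of Joseph. -/
theorem pow_le_finrank_mul_finrank [CharZero K] (h : IsWeylFamily X D) {G : ℕ → Submodule K V}
    (hG : IsGoodFiltration X D G) [∀ j, FiniteDimensional K (G j)] {v : V} (hv0 : v ≠ 0)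
    (hv : v ∈ G 0) (t : ℕ) :
    (t + 1) ^ (2 * n) ≤
      Module.finrank K (G (2 * n * t)) * Module.finrank K (G (2 * n * t + 2 * n * t)) := by
  -- The `(t + 1) ^ (2 * n)` monomials with every exponent at most `t` have degree at most `2 * n *
  -- t`. They suffice as a lower bound for the space of symbols of degree at most `d`.
  set d := 2 * n * t with hd
  let ex : (Fin n ⊕ Fin n → Fin (t + 1)) → (Fin n ⊕ Fin n →₀ ℕ) := fun e =>
    Finsupp.equivFunOnFinite.symm fun a => (e a : ℕ)
  have hex : Function.Injective ex := by
    intro e e' he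
    funext a
    exact Fin.ext (DFunLike.congr_fun he a)
  have hdeg : ∀ e, (ex e).degree ≤ d := by
    intro e
    rw [Finsupp.degree_eq_sum]
    calc ∑ a, ex e a ≤ ∑ _a : Fin n ⊕ Fin n, t :=
          Finset.sum_le_sum fun a _ => Nat.lt_succ_iff.mp (e a).2
      _ = d := by simp [hd, two_mul, add_mul]
  let W := MvPolynomial.restrictTotalDegree (Fin n ⊕ Fin n) K d
  -- Joseph's argument: symbols of degree at most `d` embed into `Hom(G d, G (2d))`, whose dimension
  -- is the product on the right.
  let Φ : W →ₗ[K] (G d →ₗ[K] G (d + d)) :=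
    { toFun := fun p => (ofSymbol h p.1).restrict fun w hw =>
        ofSymbol_mem h hG p.1 d ((MvPolynomial.mem_restrictTotalDegree _ _ _).mp p.2) d w hw
      map_add' := fun p q => by ext w; simp
      map_smul' := fun c p => by ext w; simp }
  have hΦ : Function.Injective Φ := by
    rw [injective_iff_map_eq_zero]
    intro p hp
    apply Subtype.ext
    refine eq_zero_of_ofSymbol_eq_zero h hG hv0 hv d p.1
      ((MvPolynomial.mem_restrictTotalDegree _ _ _).mp p.2) fun w hw => ?_
    exact congrArg Subtype.val (DFunLike.congr_fun hp ⟨w, hw⟩)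
  have hli : LinearIndependent K fun e => (⟨MvPolynomial.monomial (ex e) 1, by
      rw [MvPolynomial.mem_restrictTotalDegree]
      exact (MvPolynomial.totalDegree_monomial_le _ _).trans (hdeg e)⟩ : W) := by
    apply LinearIndependent.of_comp W.subtype
    exact (MvPolynomial.basisMonomials (Fin n ⊕ Fin n) K).linearIndependent.comp ex hex
  have hcard := (hli.map' Φ (LinearMap.ker_eq_bot.mpr hΦ)).fintype_card_le_finrank
  rw [Module.finrank_linearMap] at hcard
  simpa [two_mul] using hcard

end Symbols

/-! ### Descending chains in modules of minimal growth -/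

section Chain

variable {K V : Type*} [Field K] [AddCommGroup V] [Module K V] {n : ℕ}
  {X D : Fin n → Module.End K V}

theorem IsWeylFamily.mapQ (h : IsWeylFamily X D) (N : Submodule K V)
    (hX : ∀ i, N ≤ N.comap (X i)) (hD : ∀ i, N ≤ N.comap (D i)) :
    IsWeylFamily (fun i => N.mapQ N (X i) (hX i)) (fun i => N.mapQ N (D i) (hD i)) where
  X_comm i j := by
    ext v
    exact congrArg N.mkQ (DFunLike.congr_fun (h.X_comm i j) v)
  D_comm i j := by
    ext v
    exact congrArg N.mkQ (DFunLike.congr_fun (h.D_comm i j) v)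
  D_X i j := by
    ext v
    have e := congrArg N.mkQ (DFunLike.congr_fun (h.D_X i j) v)
    split_ifs at e ⊢ <;> exact e

/-- Rank-nullity for the quotient map by `N'` restricted to `F ⊓ N`. It telescopes along a chain in
`sum_finrank_le`. -/
theorem finrank_inf_eq (F N N' : Submodule K V) [FiniteDimensional K F] (hN : N' ≤ N) :
    Module.finrank K (F ⊓ N : Submodule K V) =
      Module.finrank K ((F ⊓ N).map N'.mkQ) + Module.finrank K (F ⊓ N' : Submodule K V) := by
  have hfd : FiniteDimensional K (F ⊓ N : Submodule K V) :=
    Submodule.finiteDimensional_of_le inf_le_left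
  have h := (N'.mkQ.domRestrict (F ⊓ N)).finrank_range_add_finrank_ker
  rw [LinearMap.range_domRestrict] at h
  have hker : (LinearMap.ker (N'.mkQ.domRestrict (F ⊓ N))).map (F ⊓ N).subtype = F ⊓ N' := by
    rw [LinearMap.ker_domRestrict, Submodule.ker_mkQ, Submodule.map_comap_subtype, inf_assoc,
      inf_eq_right.mpr hN]
  rw [← hker, Submodule.finrank_map_subtype_eq, h]

theorem sum_finrank_le (F : Submodule K V) [FiniteDimensional K F] (N : ℕ → Submodule K V)
    (hN : Antitone N) (r : ℕ) :
    ∑ m ∈ Finset.range r, Module.finrank K ((F ⊓ N m).map (N (m + 1)).mkQ) ≤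
      Module.finrank K F := by
  have h : ∀ r, ∑ m ∈ Finset.range r, Module.finrank K ((F ⊓ N m).map (N (m + 1)).mkQ) +
      Module.finrank K (F ⊓ N r : Submodule K V) =
        Module.finrank K (F ⊓ N 0 : Submodule K V) := by
    intro r
    induction r with
    | zero => simp
    | succ r ih => rw [Finset.sum_range_succ, add_assoc, ← finrank_inf_eq _ _ _ (hN r.le_succ), ih]
  exact (Nat.le_add_right _ _).trans ((h r).le.trans (Submodule.finrank_mono inf_le_left))

/-- In a module with a filtration of growth of order `n`, descending chains of submodules
stabilize. -/
theorem exists_mem_succ_of_growth [CharZero K] (h : IsWeylFamily X D) {G : ℕ → Submodule K V}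
    (hG : IsGoodFiltration X D G) [∀ j, FiniteDimensional K (G j)] {E : ℕ}
    (hE : ∀ j, Module.finrank K (G j) ≤ (E * (j + 1)) ^ n) {N : ℕ → Submodule K V}
    (hN : Antitone N) (hX : ∀ m i, N m ≤ (N m).comap (X i))
    (hD : ∀ m i, N m ≤ (N m).comap (D i)) {w : ℕ → V} (hw : ∀ m, w m ∈ N m)
    (hwG : ∀ m, ∃ j, w m ∈ G j) : ∃ m, w m ∈ N (m + 1) := by
  by_contra! hne
  choose J₀ hJ₀ using hwG
  -- Each of the first `r` quotients will contribute at least `(t + 1) ^ n / F ^ n` to a space of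
  -- dimension at most `F ^ n * (t + 1) ^ n`, so `r > F ^ n * F ^ n` is contradictory.
  set F := E * (4 * n + 1) with hF
  set r := F ^ n * F ^ n + 1 with hr
  obtain ⟨J, hJ⟩ : ∃ J, ∀ m ∈ Finset.range r, J₀ m ≤ J :=
    ⟨(Finset.range r).sup J₀, fun m hm => Finset.le_sup hm⟩
  -- `J` depends on `r`, so `F` must not depend on `J`. With `t = J` the shift is absorbed: `j + J +
  -- 1 ≤ (4 * n + 1) * (t + 1)` for `j ≤ 4 * n * t`.
  set t := J with ht
  have hdim : ∀ j, j ≤ 4 * n * t → Module.finrank K (G (j + J)) ≤ F ^ n * (t + 1) ^ n := by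
    intro j hj
    refine (hE _).trans ?_
    rw [← mul_pow, hF, mul_assoc]
    gcongr
    nlinarith
  have hlow : ∀ m ∈ Finset.range r, (t + 1) ^ n ≤
      Module.finrank K ((G (2 * n * t + J) ⊓ N m).map (N (m + 1)).mkQ) * F ^ n := by
    intro m hm
    -- The filtration induced on `N m / N (m + 1)`, viewed inside `V ⧸ N (m + 1)`. The shift by `J`
    -- places the nonzero class of `w m` in degree `0`.
    let G' : ℕ → Submodule K (V ⧸ N (m + 1)) := fun j => (G (j + J) ⊓ N m).map (N (m + 1)).mkQ
    have hG' : IsGoodFiltration (fun i => (N (m + 1)).mapQ _ (X i) (hX _ i))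
        (fun i => (N (m + 1)).mapQ _ (D i) (hD _ i)) G' := by
      refine ⟨fun i j hij => Submodule.map_mono (inf_le_inf_right _ (hG.mono (by omega))), ?_, ?_⟩
      · rintro i j _ ⟨v, ⟨hv, hv'⟩, rfl⟩
        refine ⟨X i v, ⟨?_, hX m i hv'⟩, rfl⟩
        have := hG.X_mem i _ v hv
        rwa [add_right_comm] at this
      · rintro i j _ ⟨v, ⟨hv, hv'⟩, rfl⟩
        refine ⟨D i v, ⟨?_, hD m i hv'⟩, rfl⟩
        have := hG.D_mem i _ v hv
        rwa [add_right_comm] at this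
    have hfd : ∀ j, FiniteDimensional K (G (j + J) ⊓ N m : Submodule K V) := fun j =>
      Submodule.finiteDimensional_of_le inf_le_left
    have hfd' : ∀ j, FiniteDimensional K (G' j) := fun j => inferInstanceAs
      (FiniteDimensional K ((G (j + J) ⊓ N m).map (N (m + 1)).mkQ))
    have h0 : (N (m + 1)).mkQ (w m) ≠ 0 := by
      rw [Submodule.mkQ_apply, Ne, Submodule.Quotient.mk_eq_zero]
      exact hne m
    have h1 : (N (m + 1)).mkQ (w m) ∈ G' 0 :=
      ⟨w m, ⟨hG.mono (by simpa using hJ m hm) (hJ₀ m), hw m⟩, rfl⟩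
    have key := pow_le_finrank_mul_finrank (h.mapQ _ (hX (m + 1)) (hD (m + 1))) hG' h0 h1 t
    have h2 : Module.finrank K (G' (2 * n * t + 2 * n * t)) ≤ F ^ n * (t + 1) ^ n :=
      (Submodule.finrank_map_le _ _).trans ((Submodule.finrank_mono inf_le_left).trans
        (hdim _ (by nlinarith)))
    have h3 := key.trans (Nat.mul_le_mul_left _ h2)
    -- One factor `(t + 1) ^ n` of the lower bound cancels against the upper bound for the larger
    -- step of the filtration.
    rw [two_mul n, pow_add, ← mul_assoc, ← two_mul n] at h3
    exact Nat.le_of_mul_le_mul_right h3 (pow_pos (Nat.succ_pos t) n)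
  have hsum := (Finset.sum_le_sum hlow).trans_eq (Finset.sum_mul _ _ _).symm
  rw [Finset.sum_const, Finset.card_range, smul_eq_mul] at hsum
  have hup := (sum_finrank_le (G (2 * n * t + J)) N hN r).trans (hdim _ (by nlinarith))
  have := hsum.trans (Nat.mul_le_mul_right _ hup)
  have hpos : 0 < (t + 1) ^ n := by positivity
  rw [hr] at this
  nlinarith

end Chain

/-! ### Passage from a domain to its fraction field -/

section Domain

variable {R M : Type*} [CommRing R] [IsDomain R] [CharZero R] [AddCommGroup M] [Module R M] {n : ℕ}

/-- In a module over a domain with an action of the Weyl algebra and a filtration of growth of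
order `n`, descending chains of submodules stabilize up to torsion. -/
theorem exists_smul_mem_succ_of_growth {X D : Fin n → Module.End R M}
    (hXX : ∀ i j, X i * X j = X j * X i) (hDD : ∀ i j, D i * D j = D j * D i)
    (hDX : ∀ i j, D i * X j = X j * D i + if i = j then 1 else 0)
    {G : ℕ → Submodule R M} (hG : Monotone G)
    (hGX : ∀ i j, ∀ v ∈ G j, X i v ∈ G (j + 1)) (hGD : ∀ i j, ∀ v ∈ G j, D i v ∈ G (j + 1))
    {E : ℕ} (hE : ∀ j, ∃ s : Finset M, s.card ≤ (E * (j + 1)) ^ n ∧ G j ≤ Submodule.span R s)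
    {T : ℕ → Submodule R M} (hT : Antitone T) (hTX : ∀ m i, ∀ v ∈ T m, X i v ∈ T m)
    (hTD : ∀ m i, ∀ v ∈ T m, D i v ∈ T m) {w : ℕ → M} (hw : ∀ m, w m ∈ T m)
    (hwG : ∀ m, ∃ j, w m ∈ G j) : ∃ m, ∃ b : R, b ≠ 0 ∧ b • w m ∈ T (m + 1) := by
  let S := nonZeroDivisors R
  let K := FractionRing R
  let V := LocalizedModule S M
  let ι : M →ₗ[R] V := LocalizedModule.mkLinearMap S M
  let ext : Module.End R M → Module.End K V := IsLocalizedModule.mapExtendScalars S ι ι K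
  have hext : ∀ φ v, ext φ (ι v) = ι (φ v) := fun φ v => IsLocalizedModule.map_apply S ι ι φ v
  have hhom : ∀ φ ψ : Module.End K V, (∀ v, φ (ι v) = ψ (ι v)) → φ = ψ := by
    intro φ ψ hφ
    have : (φ.restrictScalars R) = ψ.restrictScalars R :=
      IsLocalizedModule.linearMap_ext S ι ι (LinearMap.ext hφ)
    exact LinearMap.ext fun v => DFunLike.congr_fun this v
  have hfam : IsWeylFamily (fun i => ext (X i)) (fun i => ext (D i)) := by
    refine ⟨fun i j => hhom _ _ fun v => ?_, fun i j => hhom _ _ fun v => ?_,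
      fun i j => hhom _ _ fun v => ?_⟩
    · simp only [Module.End.mul_apply, hext]
      exact congrArg ι (DFunLike.congr_fun (hXX i j) v)
    · simp only [Module.End.mul_apply, hext]
      exact congrArg ι (DFunLike.congr_fun (hDD i j) v)
    · have e := congrArg ι (DFunLike.congr_fun (hDX i j) v)
      simp only [Module.End.mul_apply, hext, LinearMap.add_apply] at e ⊢
      rw [e, map_add]
      split_ifs <;> simp
  let loc : Submodule R M → Submodule K V := fun N => N.localized' K S ι
  have hstab : ∀ (φ : Module.End R M) (N N' : Submodule R M), (∀ v ∈ N, φ v ∈ N') →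
      ∀ v ∈ loc N, ext φ v ∈ loc N' := by
    rintro φ N N' hφ _ ⟨m, hm, s, rfl⟩
    exact ⟨φ m, hφ m hm, s, (IsLocalizedModule.map_mk' S ι ι φ m s).symm⟩
  have hmono : ∀ {N N' : Submodule R M}, N ≤ N' → loc N ≤ loc N' := by
    rintro N N' hN _ ⟨m, hm, s, rfl⟩
    exact ⟨m, hN hm, s, rfl⟩
  have hmem : ∀ {N : Submodule R M} {v}, v ∈ N → ι v ∈ loc N := fun {N v} hv =>
    ⟨v, hv, 1, IsLocalizedModule.mk'_one S ι v⟩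
  have hfin : ∀ j, FiniteDimensional K (loc (G j)) ∧
      Module.finrank K (loc (G j)) ≤ (E * (j + 1)) ^ n := by
    classical
    intro j
    obtain ⟨s, hs, e⟩ := hE j
    have e' : loc (G j) ≤ Submodule.span K (s.image ι : Finset V) := by
      refine (hmono e).trans_eq ?_
      simp only [loc, Submodule.localized'_span, Finset.coe_image]
    exact ⟨Submodule.finiteDimensional_of_le e', (Submodule.finrank_mono e').trans
      ((finrank_span_finset_le_card _).trans (Finset.card_image_le.trans hs))⟩
  have _ : ∀ j, FiniteDimensional K (loc (G j)) := fun j => (hfin j).1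
  have _ : CharZero K := charZero_of_injective_algebraMap (IsFractionRing.injective R K)
  obtain ⟨m, hm⟩ := exists_mem_succ_of_growth hfam (G := fun j => loc (G j))
    ⟨fun i j hij => hmono (hG hij), fun i j => hstab _ _ _ (hGX i j),
      fun i j => hstab _ _ _ (hGD i j)⟩ (fun j => (hfin j).2) (N := fun m => loc (T m))
    (fun i j hij => hmono (hT hij)) (fun m i => hstab _ _ _ (hTX m i))
    (fun m i => hstab _ _ _ (hTD m i)) (w := fun m => ι (w m)) (fun m => hmem (hw m))
    (fun m => (hwG m).imp fun j hj => hmem hj)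
  obtain ⟨v, hv, s, e⟩ := hm
  rw [IsLocalizedModule.mk'_eq_iff] at e
  -- Equality in the localized module lifts to `M` only after multiplication by a further nonzero
  -- `c`, since `M` may have torsion.
  obtain ⟨c, hc⟩ := IsLocalizedModule.exists_of_eq (S := S) (f := ι)
    (show ι v = ι (s • w m) by rw [e]; exact (map_smul ι (s : R) (w m)).symm)
  refine ⟨m, (c : R) * s, mul_ne_zero (nonZeroDivisors.ne_zero c.2)
    (nonZeroDivisors.ne_zero s.2), ?_⟩
  rw [mul_smul]
  have : c • s • w m ∈ T (m + 1) := hc ▸ (T (m + 1)).smul_mem (c : R) hv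
  exact this

end Domain

/-! ### Computing with the action of `D[s]` -/

section Action

variable {n : ℕ} {A : Type*} [CommRing A] [Algebra ℂ A] [PartialDerivatives n A]

theorem WeylAlgebra.induction {p : WeylAlgebra n A → Prop}
    (coeff : ∀ a, p (WeylAlgebra.coeff n A a)) (partialOp : ∀ i, p (WeylAlgebra.partialOp n A i))
    (add : ∀ P Q, p P → p Q → p (P + Q)) (mul : ∀ P Q, p P → p Q → p (P * Q))
    (P : WeylAlgebra n A) : p P := by
  obtain ⟨x, rfl⟩ : ∃ x, WeylAlgebra.mk n A x = P :=
    RingQuot.mkAlgHom_surjective ℂ (WeylRel n A) P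
  induction x using FreeAlgebra.induction with
  | grade0 c => rw [← WeylAlgebra.mk_rel (WeylRel.scalar c)]; exact coeff _
  | grade1 z => exact z.rec coeff partialOp
  | mul x y hx hy => rw [map_mul]; exact mul _ _ hx hy
  | add x y hx hy => rw [map_add]; exact add _ _ hx hy

theorem weylPoly_induction {p : (WeylAlgebra n A)[X] → Prop}
    (coeff : ∀ a, p (C (WeylAlgebra.coeff n A a)))
    (partialOp : ∀ i, p (C (WeylAlgebra.partialOp n A i))) (var : p X)
    (add : ∀ P Q, p P → p Q → p (P + Q)) (mul : ∀ P Q, p P → p Q → p (P * Q))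
    (P : (WeylAlgebra n A)[X]) : p P := by
  have hC : ∀ Q, p (C Q) := fun Q => by
    refine WeylAlgebra.induction (p := fun Q => p (C Q)) coeff partialOp
      (fun P Q hP hQ => ?_) (fun P Q hP hQ => ?_) Q
    · rw [C_add]; exact add _ _ hP hQ
    · rw [C_mul]; exact mul _ _ hP hQ
  induction P using Polynomial.induction_on with
  | C a => exact hC a
  | add P Q hP hQ => exact add _ _ hP hQ
  | monomial k a h => rw [pow_succ, ← mul_assoc]; exact mul _ _ h var

theorem algebraMap_eq_coeff (c : ℂ) :
    algebraMap ℂ (WeylAlgebra n A) c = WeylAlgebra.coeff n A (algebraMap ℂ A c) := by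
  rw [← AlgHom.commutes (WeylAlgebra.mk n A) c]
  exact (WeylAlgebra.mk_rel (WeylRel.scalar c)).symm

variable (f : A)

theorem weylPolyAction_coeff (a : A) (g : (Localization.Away f)[X]) :
    weylPolyAction n f (C (WeylAlgebra.coeff n A a)) g = C (algebraMap A _ a) * g := by
  have h := coeff_smul n f a g
  change weylPolyAction n f _ (g * 1) = (C _ * g) * 1 at h
  rwa [mul_one, mul_one] at h

theorem weylPolyAction_partialOp (i : Fin n) (g : (Localization.Away f)[X]) :
    weylPolyAction n f (C (WeylAlgebra.partialOp n A i)) g = twistedDer n f i g := by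
  have h := partialOp_smul n f i g
  change weylPolyAction n f _ (g * 1) = (coeffDer n f i g + X * g * C (logDer n f i)) * 1 at h
  rw [mul_one, mul_one] at h
  rw [h, twistedDer_apply, mul_right_comm]

theorem weylPolyAction_X (g : (Localization.Away f)[X]) :
    weylPolyAction n f X g = X * g := by
  have h := s_smul n f g
  change weylPolyAction n f _ (g * 1) = (X * g) * 1 at h
  rwa [mul_one, mul_one] at h

theorem weylPolyAction_mul (P Q : (WeylAlgebra n A)[X]) (g : (Localization.Away f)[X]) :
    weylPolyAction n f (P * Q) g = weylPolyAction n f P (weylPolyAction n f Q g) := by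
  rw [map_mul, Module.End.mul_apply]

theorem weylPolyAction_add (P Q : (WeylAlgebra n A)[X]) (g : (Localization.Away f)[X]) :
    weylPolyAction n f (P + Q) g = weylPolyAction n f P g + weylPolyAction n f Q g := by
  rw [map_add, LinearMap.add_apply]

theorem weylPolyAction_sub (P Q : (WeylAlgebra n A)[X]) (g : (Localization.Away f)[X]) :
    weylPolyAction n f (P - Q) g = weylPolyAction n f P g - weylPolyAction n f Q g := by
  rw [eq_sub_iff_add_eq, ← weylPolyAction_add, sub_add_cancel]

theorem weylPolyAction_scalar (b : ℂ[X]) (g : (Localization.Away f)[X]) :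
    weylPolyAction n f (b.map (algebraMap ℂ (WeylAlgebra n A))) g =
      b.map (algebraMap ℂ (Localization.Away f)) * g := by
  induction b using Polynomial.induction_on with
  | C c =>
    rw [map_C, map_C, algebraMap_eq_coeff, weylPolyAction_coeff,
      ← IsScalarTower.algebraMap_apply]
  | add p q hp hq => simp only [Polynomial.map_add, weylPolyAction_add, hp, hq, add_mul]
  | monomial k a h =>
    have e : (C a * X ^ (k + 1) : ℂ[X]) = X * (C a * X ^ k) := by ring
    rw [e, Polynomial.map_mul (p := X), Polynomial.map_mul (p := X), weylPolyAction_mul, h, map_X,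
      map_X, weylPolyAction_X, mul_assoc]

theorem commute_map_algebraMap (b : ℂ[X]) (P : (WeylAlgebra n A)[X]) :
    Commute P (b.map (algebraMap ℂ (WeylAlgebra n A))) := by
  induction b using Polynomial.induction_on with
  | C c => rw [map_C]; exact (Algebra.commutes c P).symm
  | add p q hp hq => rw [Polynomial.map_add]; exact hp.add_right hq
  | monomial k a h =>
    rw [pow_succ, ← mul_assoc, Polynomial.map_mul, map_X]
    exact h.mul_right (commute_X P).symm

theorem weylPolyAction_scalar_mul (P : (WeylAlgebra n A)[X]) (b : ℂ[X])
    (g : (Localization.Away f)[X]) :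
    weylPolyAction n f P (b.map (algebraMap ℂ (Localization.Away f)) * g) =
      b.map (algebraMap ℂ (Localization.Away f)) * weylPolyAction n f P g := by
  rw [← weylPolyAction_scalar (n := n), ← weylPolyAction_mul, (commute_map_algebraMap b P).eq,
    weylPolyAction_mul, weylPolyAction_scalar]

theorem mem_annFPow (P : (WeylAlgebra n A)[X]) :
    P ∈ annFPow n f ↔ weylPolyAction n f P 1 = 0 := Iff.rfl

theorem functionalEquation_iff (b : ℂ[X]) :
    FunctionalEquation n f b ↔ ∃ P : (WeylAlgebra n A)[X],
      weylPolyAction n f P (C (algebraMap A _ f)) = b.map (algebraMap ℂ (Localization.Away f)) := by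
  refine exists_congr fun P => ?_
  change weylPolyAction n f _ 1 = weylPolyAction n f _ 1 ↔ _
  rw [weylPolyAction_mul, weylPolyAction_coeff, weylPolyAction_scalar, mul_one, mul_one]

theorem FunctionalEquation.mul_left {f : A} {b : ℂ[X]} (h : FunctionalEquation n f b) (c : ℂ[X]) :
    FunctionalEquation n f (c * b) := by
  rw [functionalEquation_iff] at h ⊢
  obtain ⟨P, hP⟩ := h
  exact ⟨c.map (algebraMap ℂ (WeylAlgebra n A)) * P, by
    rw [weylPolyAction_mul, hP, weylPolyAction_scalar, Polynomial.map_mul]⟩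

/-- An additive map which carries the action of each generator of `D[s]` to the action of some
operator does so for every operator. -/
theorem exists_intertwining {B : Type*} [CommRing B] [Algebra ℂ B] [PartialDerivatives n B] {f : A}
    {g : B} (T : (Localization.Away f)[X] →+ (Localization.Away g)[X])
    (coeff : ∀ a, ∃ Q, ∀ u, T (weylPolyAction n f (C (WeylAlgebra.coeff n A a)) u) =
      weylPolyAction n g Q (T u))
    (partialOp : ∀ i, ∃ Q, ∀ u, T (weylPolyAction n f (C (WeylAlgebra.partialOp n A i)) u) =
      weylPolyAction n g Q (T u))
    (var : ∃ Q, ∀ u, T (weylPolyAction n f X u) = weylPolyAction n g Q (T u))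
    (P : (WeylAlgebra n A)[X]) :
    ∃ Q, ∀ u, T (weylPolyAction n f P u) = weylPolyAction n g Q (T u) := by
  induction P using weylPoly_induction with
  | coeff a => exact coeff a
  | partialOp i => exact partialOp i
  | var => exact var
  | add P P' h h' =>
    obtain ⟨Q, hQ⟩ := h
    obtain ⟨Q', hQ'⟩ := h'
    exact ⟨Q + Q', fun u => by rw [weylPolyAction_add, weylPolyAction_add, map_add, hQ, hQ']⟩
  | mul P P' h h' =>
    obtain ⟨Q, hQ⟩ := h
    obtain ⟨Q', hQ'⟩ := h'
    exact ⟨Q * Q', fun u => by rw [weylPolyAction_mul, weylPolyAction_mul, hQ, hQ']⟩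

end Action

/-! ### Change of the coefficient ring -/

section BaseChange

variable {A B : Type*} [CommRing A] [CommRing B] (φ : A →+* B) (f : A)

/-- The ring homomorphism `A[1/f] → B[1/φ(f)]`. -/
def awayMap : Localization.Away f →+* Localization.Away (φ f) :=
  IsLocalization.Away.map _ _ φ f

theorem awayMap_algebraMap (a : A) :
    awayMap φ f (algebraMap A _ a) = algebraMap B _ (φ a) :=
  IsLocalization.lift_eq _ _

theorem awayMap_invSelf :
    awayMap φ f (IsLocalization.Away.invSelf f) = IsLocalization.Away.invSelf (φ f) := by
  have hu : IsUnit (algebraMap B (Localization.Away (φ f)) (φ f)) :=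
    IsLocalization.Away.algebraMap_isUnit _
  apply hu.mul_left_cancel
  rw [IsLocalization.Away.mul_invSelf, ← awayMap_algebraMap, ← map_mul,
    IsLocalization.Away.mul_invSelf, map_one]

theorem awayMap_injective (hφ : Function.Injective φ) :
    Function.Injective (awayMap φ f) :=
  (IsLocalization.Away.map_injective_iff _ φ f).mpr fun a ha =>
    ⟨0, by rw [(map_eq_zero_iff φ hφ).mp ha, mul_zero]⟩

variable {φ}
variable {n : ℕ} [Algebra ℂ A] [PartialDerivatives n A] [Algebra ℂ B] [PartialDerivatives n B]
variable (hφ : ∀ (i : Fin n) a, φ (PartialDerivatives.der i a) = PartialDerivatives.der i (φ a))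

include hφ

theorem awayMap_der (i : Fin n) (g : Localization.Away f) :
    awayMap φ f (PartialDerivatives.der i g) = PartialDerivatives.der i (awayMap φ f g) := by
  obtain ⟨⟨a, y⟩, hg⟩ := IsLocalization.surj (Submonoid.powers f) g
  have hu := (IsLocalization.map_units (Localization.Away f) y).map (awayMap φ f)
  have e₁ := congrArg (fun z => awayMap φ f (PartialDerivatives.der i z)) hg
  have e₂ := congrArg (fun z => PartialDerivatives.der i (awayMap φ f z)) hg
  simp only [Derivation.leibniz, smul_eq_mul, map_add, map_mul, der_algebraMap,
    awayMap_algebraMap, hφ] at e₁ e₂ hu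
  apply hu.mul_left_cancel
  linear_combination e₁ - e₂

theorem awayMap_logDer (i : Fin n) : awayMap φ f (logDer n f i) = logDer n (φ f) i := by
  rw [logDer, logDer, map_mul, awayMap_algebraMap, awayMap_invSelf, hφ]

theorem map_twistedDer (i : Fin n) (g : (Localization.Away f)[X]) :
    (twistedDer n f i g).map (awayMap φ f) = twistedDer n (φ f) i (g.map (awayMap φ f)) := by
  rw [twistedDer_apply, twistedDer_apply, Polynomial.map_add, Polynomial.map_mul,
    Polynomial.map_mul, map_X, map_C, awayMap_logDer f hφ]
  congr 1
  ext k
  rw [coeff_map, coeffDer_coeff, coeffDer_coeff, coeff_map, awayMap_der f hφ]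

/-- Only the effect of operators on the module matters, so it is enough to produce some `Q` for each
`P`. No homomorphism between the two Weyl algebras is constructed. -/
theorem exists_baseChange (P : (WeylAlgebra n A)[X]) : ∃ Q : (WeylAlgebra n B)[X], ∀ u,
    (weylPolyAction n f P u).map (awayMap φ f) =
      weylPolyAction n (φ f) Q (u.map (awayMap φ f)) := by
  refine exists_intertwining (Polynomial.mapRingHom (awayMap φ f)).toAddMonoidHom
    (fun a => ⟨C (WeylAlgebra.coeff n B (φ a)), fun u => ?_⟩)
    (fun i => ⟨C (WeylAlgebra.partialOp n B i), fun u => ?_⟩) ⟨X, fun u => ?_⟩ P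
  · change Polynomial.map _ _ = weylPolyAction _ _ _ (Polynomial.map _ _)
    rw [weylPolyAction_coeff, weylPolyAction_coeff, Polynomial.map_mul, map_C, awayMap_algebraMap]
  · change Polynomial.map _ _ = weylPolyAction _ _ _ (Polynomial.map _ _)
    rw [weylPolyAction_partialOp, weylPolyAction_partialOp, map_twistedDer f hφ]
  · change Polynomial.map _ _ = weylPolyAction _ _ _ (Polynomial.map _ _)
    rw [weylPolyAction_X, weylPolyAction_X, Polynomial.map_mul, map_X]

end BaseChange

/-! ### Clearing denominators of operators -/

section Denominators

variable {n : ℕ} {A B : Type*} [CommRing A] [Algebra ℂ A] [PartialDerivatives n A]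
  [CommRing B] [Algebra ℂ B] [PartialDerivatives n B] [Algebra A B] (S : Submonoid A)
  [IsLocalization S B] (f : A)

/-- If `B` is a localization of `A`, then an element of `D_B[s] v` becomes an element of `D_A[s] v`
after multiplication by a denominator. -/
theorem exists_clear_denominators (hφ : ∀ (i : Fin n) a,
    algebraMap A B (PartialDerivatives.der i a) =
      PartialDerivatives.der i (algebraMap A B a)) (v : (Localization.Away f)[X])
    (P : (WeylAlgebra n B)[X]) : ∃ h ∈ S, ∃ Q : (WeylAlgebra n A)[X],
      Polynomial.mapRingHom (awayMap (algebraMap A B) f) (C (algebraMap _ _ h)) *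
          weylPolyAction n _ P (Polynomial.mapRingHom (awayMap (algebraMap A B) f) v) =
        Polynomial.mapRingHom (awayMap (algebraMap A B) f) (weylPolyAction n f Q v) := by
  set T := Polynomial.mapRingHom (awayMap (algebraMap A B) f) with hT
  have hTC : ∀ a, T (C (algebraMap _ _ a)) = C (algebraMap _ _ (algebraMap A B a)) := fun a => by
    rw [hT, coe_mapRingHom, map_C, awayMap_algebraMap]
  have hTD : ∀ i g, T (twistedDer n f i g) = twistedDer n _ i (T g) :=
    fun i g => map_twistedDer f hφ i g
  have hTX : T X = X := Polynomial.map_X _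
  let good (u : (Localization.Away (algebraMap A B f))[X]) : Prop :=
    ∃ h ∈ S, ∃ Q : (WeylAlgebra n A)[X],
      T (C (algebraMap _ _ h)) * u = T (weylPolyAction n f Q v)
  -- The claim is strengthened from `v` to all good `u`, so that products of operators can be
  -- treated one factor at a time.
  suffices key : ∀ P : (WeylAlgebra n B)[X], ∀ u, good u → good (weylPolyAction n _ P u) by
    refine key P _ ⟨1, S.one_mem, 1, ?_⟩
    rw [map_one, map_one, map_one, one_mul, map_one, Module.End.one_apply]
  intro P
  induction P using weylPoly_induction with
  | coeff a =>
    rintro u ⟨h, hh, Q, hQ⟩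
    obtain ⟨⟨r, y⟩, hy⟩ := IsLocalization.surj S a
    refine ⟨y * h, S.mul_mem y.2 hh, C (WeylAlgebra.coeff n _ r) * Q, ?_⟩
    have e := congrArg (fun z => (C (algebraMap _ (Localization.Away (algebraMap A B f)) z) :
      (Localization.Away (algebraMap A B f))[X])) hy
    simp only [map_mul, ← hTC] at e
    rw [weylPolyAction_mul, weylPolyAction_coeff, weylPolyAction_coeff, map_mul T, ← hQ, ← e,
      map_mul, C_mul, map_mul]
    ring
  | partialOp i =>
    rintro u ⟨h, hh, Q, hQ⟩
    -- This is `h² ∂ᵢu = h ∂ᵢ(h u) - (∂ᵢh) (h u)`, with `h u` represented by `Q v`.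
    refine ⟨h * h, S.mul_mem hh hh,
      C (WeylAlgebra.coeff n _ h) * (C (WeylAlgebra.partialOp n _ i) * Q) -
        C (WeylAlgebra.coeff n _ (PartialDerivatives.der i h)) * Q, ?_⟩
    rw [weylPolyAction_sub, weylPolyAction_mul, weylPolyAction_mul, weylPolyAction_mul,
      weylPolyAction_coeff, weylPolyAction_coeff, weylPolyAction_partialOp,
      weylPolyAction_partialOp, map_sub, map_mul T, map_mul T, hTD, ← hQ, map_mul, C_mul, map_mul]
    simp only [hTC, twistedDer_apply, Derivation.leibniz, coeffDer_C, der_algebraMap, hφ,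
      smul_eq_mul]
    ring
  | var =>
    rintro u ⟨h, hh, Q, hQ⟩
    refine ⟨h, hh, X * Q, ?_⟩
    rw [weylPolyAction_mul, weylPolyAction_X, weylPolyAction_X, map_mul T, hTX, ← hQ]
    ring
  | add P P' ih ih' =>
    intro u hu
    obtain ⟨h, hh, Q, hQ⟩ := ih u hu
    obtain ⟨h', hh', Q', hQ'⟩ := ih' u hu
    refine ⟨h * h', S.mul_mem hh hh', C (WeylAlgebra.coeff n _ h') * Q +
      C (WeylAlgebra.coeff n _ h) * Q', ?_⟩
    rw [weylPolyAction_add, weylPolyAction_add, weylPolyAction_mul, weylPolyAction_mul,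
      weylPolyAction_coeff, weylPolyAction_coeff, map_add, map_mul T, map_mul T, ← hQ, ← hQ',
      map_mul, C_mul, map_mul]
    ring
  | mul P P' ih ih' =>
    intro u hu
    rw [weylPolyAction_mul]
    exact ih _ (ih' u hu)

end Denominators

/-! ### The substitution `s ↦ s - 1` -/

section Shift

variable {A : Type*} [CommRing A] (f : A)

/-- The substitution `s ↦ s - 1`, i.e. `g(s) f^s ↦ g(s - 1) f^(s - 1)`. -/
def shiftMap : (Localization.Away f)[X] →+ (Localization.Away f)[X] where
  toFun g := C (IsLocalization.Away.invSelf f) * g.comp (X - 1)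
  map_zero' := by simp
  map_add' g h := by rw [add_comp, mul_add]

theorem shiftMap_apply (g : (Localization.Away f)[X]) :
    shiftMap f g = C (IsLocalization.Away.invSelf f) * g.comp (X - 1) := rfl

variable {n : ℕ} [Algebra ℂ A] [PartialDerivatives n A]

theorem der_invSelf (i : Fin n) :
    PartialDerivatives.der i (IsLocalization.Away.invSelf f : Localization.Away f) =
      -(IsLocalization.Away.invSelf f * logDer n f i) := by
  have h : algebraMap A (Localization.Away f) f * IsLocalization.Away.invSelf f = 1 :=
    IsLocalization.Away.mul_invSelf f
  have e := congrArg (PartialDerivatives.der (n := n) i) h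
  simp only [Derivation.leibniz, smul_eq_mul, der_algebraMap, Derivation.map_one_eq_zero] at e
  rw [logDer]
  linear_combination (IsLocalization.Away.invSelf f) * e -
    (PartialDerivatives.der i (IsLocalization.Away.invSelf f : Localization.Away f)) * h

theorem coeffDer_comp_X_sub_one (i : Fin n) (g : (Localization.Away f)[X]) :
    coeffDer n f i (g.comp (X - 1)) = (coeffDer n f i g).comp (X - 1) := by
  induction g using Polynomial.induction_on with
  | C a => simp [coeffDer_C]
  | add p q hp hq => simp only [add_comp, map_add, hp, hq]
  | monomial k a h =>
    rw [pow_succ, ← mul_assoc, mul_comp, X_comp, Derivation.leibniz, Derivation.leibniz, h]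
    simp [coeffDer_X]

/-- Coefficients and `∂ᵢ` act on `f^(s-1)` by the same rule as on `f^s` with `s` replaced by `s -
1`, the extra term coming from `der_invSelf`. Only the operator `s` changes, to `s - 1`. -/
theorem exists_shift (P : (WeylAlgebra n A)[X]) : ∃ Q : (WeylAlgebra n A)[X], ∀ u,
    shiftMap f (weylPolyAction n f P u) = weylPolyAction n f Q (shiftMap f u) := by
  refine exists_intertwining (shiftMap f)
    (fun a => ⟨C (WeylAlgebra.coeff n A a), fun u => ?_⟩)
    (fun i => ⟨C (WeylAlgebra.partialOp n A i), fun u => ?_⟩) ⟨X - 1, fun u => ?_⟩ P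
  · rw [weylPolyAction_coeff, weylPolyAction_coeff, shiftMap_apply, shiftMap_apply, mul_comp,
      C_comp]
    ring
  · rw [weylPolyAction_partialOp, weylPolyAction_partialOp, shiftMap_apply, shiftMap_apply,
      twistedDer_apply, twistedDer_apply, add_comp, mul_comp, mul_comp, X_comp, C_comp,
      Derivation.leibniz, coeffDer_C, der_invSelf, coeffDer_comp_X_sub_one, smul_eq_mul,
      smul_eq_mul, C_neg, C_mul]
    ring
  · rw [weylPolyAction_sub, map_one, weylPolyAction_X, weylPolyAction_X,
      Module.End.one_apply, shiftMap_apply, shiftMap_apply, mul_comp, X_comp]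
    ring

/-- Each shift removes one factor `f` from both sides and replaces `b(s)` by `b(s - 1)`, which is
still nonzero. -/
theorem exists_functionalEquation_of_pow {b : ℂ[X]} (hb : b ≠ 0) (m : ℕ)
    (P : (WeylAlgebra n A)[X])
    (hP : weylPolyAction n f P (C (algebraMap A _ f ^ (m + 1))) =
      b.map (algebraMap ℂ (Localization.Away f)) * C (algebraMap A _ f ^ m)) :
    ∃ b : ℂ[X], b ≠ 0 ∧ FunctionalEquation n f b := by
  induction m generalizing b P with
  | zero =>
    refine ⟨b, hb, (functionalEquation_iff f b).mpr ⟨P, ?_⟩⟩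
    simpa using hP
  | succ m ih =>
    have h : algebraMap A (Localization.Away f) f * IsLocalization.Away.invSelf f = 1 :=
      IsLocalization.Away.mul_invSelf f
    have hpow : ∀ k, (C (IsLocalization.Away.invSelf f) : (Localization.Away f)[X]) *
        C (algebraMap A (Localization.Away f) f ^ (k + 1)) = C (algebraMap A _ f ^ k) := by
      intro k
      rw [← C_mul, pow_succ]
      congr 1
      linear_combination (algebraMap A (Localization.Away f) f ^ k) * h
    obtain ⟨Q, hQ⟩ := exists_shift f P
    have e := hQ (C (algebraMap A _ f ^ (m + 1 + 1)))
    rw [hP, shiftMap_apply, shiftMap_apply, mul_comp, C_comp, C_comp, mul_left_comm, hpow,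
      hpow] at e
    refine ih (b := b.comp (X - 1)) ?_ Q ?_
    · intro h0
      have h1 := congrArg (fun q : ℂ[X] => q.comp (X + 1)) h0
      simp only [comp_assoc, sub_comp, X_comp, one_comp, add_sub_cancel_right, comp_X,
        zero_comp] at h1
      exact hb h1
    · rw [← e, Polynomial.map_comp]
      simp

end Shift

/-! ### Bernstein's theorem for `ℂ[x][s, 1/f] f^s` -/

section Bernstein

variable {n : ℕ} (f : MvPolynomial (Fin n) ℂ)

/-- `A[1/f][s]` as an algebra over `ℂ[s]`. -/
@[reducible] def polyAlgebra {A : Type*} [CommRing A] [Algebra ℂ A] : Algebra ℂ[X] A[X] :=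
  (Polynomial.mapRingHom (algebraMap ℂ A)).toAlgebra

attribute [local instance] polyAlgebra

theorem poly_smul_def {A : Type*} [CommRing A] [Algebra ℂ A] (b : ℂ[X]) (g : A[X]) :
    b • g = b.map (algebraMap ℂ A) * g := Algebra.smul_def b g

/-- The elements `g f^{-j}` with `deg g ≤ j (deg f + 1)`. -/
def growthSet (j : ℕ) : Set (Localization.Away f)[X] :=
  {v | ∃ g : MvPolynomial (Fin n) ℂ, g.totalDegree ≤ j * (f.totalDegree + 1) ∧
    v = C (algebraMap _ _ g * IsLocalization.Away.invSelf f ^ j)}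

/-- The filtration of `ℂ[x][s, 1/f]` by the order of the pole and the degree of the numerator. -/
def growthFiltration (j : ℕ) : Submodule ℂ[X] (Localization.Away f)[X] :=
  Submodule.span ℂ[X] (growthSet f j)

theorem mem_growthFiltration {j : ℕ} {g : MvPolynomial (Fin n) ℂ}
    (hg : g.totalDegree ≤ j * (f.totalDegree + 1)) :
    C (algebraMap _ (Localization.Away f) g * IsLocalization.Away.invSelf f ^ j) ∈
      growthFiltration f j := Submodule.subset_span ⟨g, hg, rfl⟩

theorem algebraMap_mul_invSelf_pow (g : MvPolynomial (Fin n) ℂ) (j : ℕ) :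
    algebraMap _ (Localization.Away f) g * IsLocalization.Away.invSelf f ^ j =
      algebraMap _ (Localization.Away f) (g * f) * IsLocalization.Away.invSelf f ^ (j + 1) := by
  have h : algebraMap _ (Localization.Away f) f * IsLocalization.Away.invSelf f = 1 :=
    IsLocalization.Away.mul_invSelf f
  rw [map_mul, pow_succ]
  linear_combination (-algebraMap _ (Localization.Away f) g *
    IsLocalization.Away.invSelf f ^ j) * h

theorem growthFiltration_mono : Monotone (growthFiltration f) := by
  refine monotone_nat_of_le_succ fun j => Submodule.span_le.mpr ?_
  rintro _ ⟨g, hg, rfl⟩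
  rw [algebraMap_mul_invSelf_pow]
  refine mem_growthFiltration f ((MvPolynomial.totalDegree_mul _ _).trans ?_)
  rw [add_mul]
  omega

theorem growthFiltration_le_span (j : ℕ) : ∃ s : Finset (Localization.Away f)[X],
    s.card ≤ ((f.totalDegree + 1) * (j + 1)) ^ n ∧
      growthFiltration f j ≤ Submodule.span ℂ[X] s := by
  classical
  set N := j * (f.totalDegree + 1) with hN
  -- Monomials of degree at most `N` lie in the box of exponents at most `N`, which has `(N + 1) ^
  -- n` elements, and `N + 1 ≤ (deg f + 1) (j + 1)`.
  let mon : (Fin n → Fin (N + 1)) → (Localization.Away f)[X] := fun e =>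
    C (algebraMap _ _ (MvPolynomial.monomial
      (Finsupp.equivFunOnFinite.symm fun a => (e a : ℕ)) (1 : ℂ)) *
        IsLocalization.Away.invSelf f ^ j)
  refine ⟨Finset.univ.image mon, Finset.card_image_le.trans ?_, Submodule.span_le.mpr ?_⟩
  · rw [Finset.card_univ, Fintype.card_fun, Fintype.card_fin, Fintype.card_fin]
    gcongr
    rw [hN]
    nlinarith
  · rintro _ ⟨g, hg, rfl⟩
    rw [g.as_sum, map_sum, Finset.sum_mul, map_sum]
    refine Submodule.sum_mem _ fun m hm => ?_
    have hm' : m.degree ≤ N := (MvPolynomial.le_totalDegree hm).trans hg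
    have e : C (algebraMap _ (Localization.Away f) (MvPolynomial.monomial m (g.coeff m)) *
        IsLocalization.Away.invSelf f ^ j) = (C (g.coeff m) : ℂ[X]) •
          mon fun a => ⟨m a, Nat.lt_succ_of_le ((Finsupp.le_degree a m).trans hm')⟩ := by
      have : (Finsupp.equivFunOnFinite.symm fun a => m a) = m := by ext; rfl
      simp only [mon, this]
      rw [poly_smul_def, map_C, ← C_mul, ← mul_assoc,
        IsScalarTower.algebraMap_apply ℂ (MvPolynomial (Fin n) ℂ) (Localization.Away f),
        ← map_mul, MvPolynomial.algebraMap_eq, MvPolynomial.C_mul_monomial, mul_one]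
    rw [e]
    exact Submodule.smul_mem _ _ (Submodule.subset_span (by simp))

/-- The operator `∂ᵢ` is linear over `ℂ[s]`. -/
def twistedDerLinear (i : Fin n) : Module.End ℂ[X] (Localization.Away f)[X] where
  toFun := twistedDer n f i
  map_add' := map_add _
  map_smul' b g := by
    have h : coeffDer n f i (b.map (algebraMap ℂ (Localization.Away f))) = 0 := by
      ext k
      simp [coeffDer_coeff]
    simp only [poly_smul_def, twistedDer_apply, Derivation.leibniz, h, smul_eq_mul, mul_zero,
      add_zero, RingHom.id_apply]
    ring

theorem twistedDerLinear_apply (i : Fin n) (g : (Localization.Away f)[X]) :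
    twistedDerLinear f i g = twistedDer n f i g := rfl

/-- Multiplication by `xᵢ`. -/
def mulVar (i : Fin n) : Module.End ℂ[X] (Localization.Away f)[X] :=
  LinearMap.mulLeft ℂ[X]
    (C (algebraMap (MvPolynomial (Fin n) ℂ) (Localization.Away f) (MvPolynomial.X i)))

theorem mulVar_apply (i : Fin n) (g : (Localization.Away f)[X]) :
    mulVar f i g =
      C (algebraMap (MvPolynomial (Fin n) ℂ) (Localization.Away f) (MvPolynomial.X i)) * g := rfl

/-- Writing `xᵢ g / f^j` over `f^(j+1)` raises the degree of the numerator by at most `deg f + 1`,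
which accounts for the slope in `growthSet`. -/
theorem mulVar_mem (i : Fin n) (j : ℕ) (v : (Localization.Away f)[X])
    (hv : v ∈ growthFiltration f j) : mulVar f i v ∈ growthFiltration f (j + 1) := by
  suffices h : growthFiltration f j ≤ (growthFiltration f (j + 1)).comap (mulVar f i) from h hv
  refine Submodule.span_le.mpr ?_
  rintro _ ⟨g, hg, rfl⟩
  change mulVar f i _ ∈ growthFiltration f (j + 1)
  rw [mulVar_apply, ← C_mul, ← mul_assoc, ← map_mul, algebraMap_mul_invSelf_pow]
  refine mem_growthFiltration f ?_
  have h₁ := MvPolynomial.totalDegree_mul (MvPolynomial.X i * g) f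
  have h₂ := MvPolynomial.totalDegree_mul (MvPolynomial.X i) g
  rw [MvPolynomial.totalDegree_X] at h₂
  rw [add_mul]
  omega

theorem totalDegree_pderiv_le (i : Fin n) (g : MvPolynomial (Fin n) ℂ) :
    (MvPolynomial.pderiv i g).totalDegree ≤ g.totalDegree := by
  refine Finset.sup_le fun m hm => ?_
  rw [MvPolynomial.mem_support_iff, MvPolynomial.coeff_pderiv] at hm
  have := MvPolynomial.le_totalDegree
    (MvPolynomial.mem_support_iff.mpr (left_ne_zero_of_mul hm))
  change (m + Finsupp.single i 1).degree ≤ _ at this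
  rw [map_add, Finsupp.degree_single] at this
  change m.degree ≤ _
  omega

/-- The quotient rule for `g f^(s-j)`. The factor `s - j` is a scalar of `ℂ[s]`, so it does not
affect the filtration, which consists of `ℂ[s]`-spans. -/
theorem twistedDer_C_mul_invSelf_pow (i : Fin n) (g : MvPolynomial (Fin n) ℂ) (j : ℕ) :
    twistedDer n f i (C (algebraMap _ _ g * IsLocalization.Away.invSelf f ^ j)) =
      C (algebraMap _ _ (MvPolynomial.pderiv i g * f) * IsLocalization.Away.invSelf f ^ (j + 1)) +
        (X - C (j : ℂ) : ℂ[X]) • C (algebraMap _ _ (g * MvPolynomial.pderiv i f) *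
          IsLocalization.Away.invSelf f ^ (j + 1)) := by
  have hpow : PartialDerivatives.der i
      ((IsLocalization.Away.invSelf f : Localization.Away f) ^ j) =
        -(j * IsLocalization.Away.invSelf f ^ j * logDer n f i) := by
    rcases j with _ | j
    · simp
    · rw [Derivation.leibniz_pow, der_invSelf, Nat.add_sub_cancel, smul_eq_mul, nsmul_eq_mul]
      ring
  have hder : ∀ h : MvPolynomial (Fin n) ℂ,
      PartialDerivatives.der i h = MvPolynomial.pderiv i h := fun _ => rfl
  rw [← algebraMap_mul_invSelf_pow, twistedDer_apply, coeffDer_C, Derivation.leibniz, hpow,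
    der_algebraMap, smul_eq_mul, smul_eq_mul, poly_smul_def, Polynomial.map_sub, map_X, map_C,
    logDer, map_mul (algebraMap _ (Localization.Away f)) g, map_natCast, hder, hder]
  generalize algebraMap _ (Localization.Away f) g = a
  generalize algebraMap _ (Localization.Away f) (MvPolynomial.pderiv i g) = a'
  generalize algebraMap _ (Localization.Away f) (MvPolynomial.pderiv i f) = f'
  generalize (IsLocalization.Away.invSelf f : Localization.Away f) = u
  simp only [C_mul, C_add, C_neg, C_pow, pow_succ]
  ring

theorem twistedDerLinear_mem (i : Fin n) (j : ℕ) (v : (Localization.Away f)[X])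
    (hv : v ∈ growthFiltration f j) : twistedDerLinear f i v ∈ growthFiltration f (j + 1) := by
  suffices h : growthFiltration f j ≤ (growthFiltration f (j + 1)).comap (twistedDerLinear f i)
    from h hv
  refine Submodule.span_le.mpr ?_
  rintro _ ⟨g, hg, rfl⟩
  change twistedDerLinear f i _ ∈ growthFiltration f (j + 1)
  rw [twistedDerLinear_apply, twistedDer_C_mul_invSelf_pow]
  refine Submodule.add_mem _ (mem_growthFiltration f ?_)
    (Submodule.smul_mem _ _ (mem_growthFiltration f ?_))
  · have h₁ := MvPolynomial.totalDegree_mul (MvPolynomial.pderiv i g) f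
    have h₂ := totalDegree_pderiv_le i g
    rw [add_mul]
    omega
  · have h₁ := MvPolynomial.totalDegree_mul g (MvPolynomial.pderiv i f)
    have h₂ := totalDegree_pderiv_le i f
    rw [add_mul]
    omega

/-- The `D[s]`-submodule generated by `f^m · f^s`. -/
def powerSubmodule (m : ℕ) : Submodule ℂ[X] (Localization.Away f)[X] where
  carrier := {v | ∃ P : (WeylAlgebra n (MvPolynomial (Fin n) ℂ))[X],
    weylPolyAction n f P (C (algebraMap _ _ f ^ m)) = v}
  zero_mem' := ⟨0, by simp⟩
  add_mem' := by
    rintro _ _ ⟨P, rfl⟩ ⟨Q, rfl⟩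
    exact ⟨P + Q, weylPolyAction_add f P Q _⟩
  smul_mem' := by
    rintro b _ ⟨P, rfl⟩
    exact ⟨b.map (algebraMap ℂ _) * P, by
      rw [weylPolyAction_mul, weylPolyAction_scalar, poly_smul_def]⟩

/-- **Bernstein's theorem**: existence of the `b`-function. -/
theorem exists_functionalEquation : ∃ b : ℂ[X], b ≠ 0 ∧ FunctionalEquation n f b := by
  classical
  -- Stabilization of the chain `D[s] f^m f^s` up to `ℂ[s]`-torsion; the torsion factor becomes the
  -- polynomial `b`.
  suffices h : ∃ m, ∃ b : ℂ[X], b ≠ 0 ∧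
      b • (C (algebraMap _ (Localization.Away f) f ^ m) : (Localization.Away f)[X]) ∈
        powerSubmodule f (m + 1) by
    obtain ⟨m, b, hb, P, hP⟩ := h
    exact exists_functionalEquation_of_pow f hb m P (by rw [hP, poly_smul_def])
  refine exists_smul_mem_succ_of_growth (X := mulVar f)
    (D := twistedDerLinear f) (G := growthFiltration f) (T := powerSubmodule f)
    (w := fun m => C (algebraMap _ _ f ^ m)) (E := f.totalDegree + 1) ?_ ?_ ?_
    (growthFiltration_mono f) (mulVar_mem f) (twistedDerLinear_mem f)
    (growthFiltration_le_span f) ?_ ?_ ?_ ?_ ?_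
  · intro i j
    refine LinearMap.ext fun g => ?_
    simp only [Module.End.mul_apply, mulVar_apply]
    ring
  · intro i j
    refine LinearMap.ext fun g => ?_
    have h : WeylAlgebra.partialOp n (MvPolynomial (Fin n) ℂ) i *
        WeylAlgebra.partialOp n _ j = WeylAlgebra.partialOp n _ j * WeylAlgebra.partialOp n _ i := by
      have := WeylAlgebra.mk_rel (WeylRel.comm (A := MvPolynomial (Fin n) ℂ) i j)
      rwa [map_mul, map_mul] at this
    have e := congrArg (fun P => weylPolyAction n f (C P) g) h
    simp only [C_mul, weylPolyAction_mul, weylPolyAction_partialOp] at e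
    exact e
  · intro i j
    refine LinearMap.ext fun g => ?_
    simp only [Module.End.mul_apply, LinearMap.add_apply, mulVar_apply, twistedDerLinear_apply,
      twistedDer_apply, Derivation.leibniz, coeffDer_C, der_algebraMap, smul_eq_mul]
    change _ + g * C (algebraMap _ _ (MvPolynomial.pderiv i (MvPolynomial.X j))) + _ = _
    rw [MvPolynomial.pderiv_X]
    by_cases hij : i = j
    · subst hij
      simp
      ring
    · simp [hij]
      ring
  · refine antitone_nat_of_succ_le fun m => ?_
    rintro _ ⟨P, rfl⟩
    exact ⟨P * C (WeylAlgebra.coeff n _ f), by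
      rw [weylPolyAction_mul, weylPolyAction_coeff, ← C_mul, pow_succ']⟩
  · rintro m i _ ⟨P, rfl⟩
    exact ⟨C (WeylAlgebra.coeff n _ (MvPolynomial.X i)) * P, by
      rw [weylPolyAction_mul, weylPolyAction_coeff, mulVar_apply]⟩
  · rintro m i _ ⟨P, rfl⟩
    exact ⟨C (WeylAlgebra.partialOp n _ i) * P, by
      rw [weylPolyAction_mul, weylPolyAction_partialOp, twistedDerLinear_apply]⟩
  · exact fun m => ⟨1, by rw [map_one, Module.End.one_apply]⟩
  · intro m
    -- Written as `f^(m + j) / f^j` with `j = m deg f`, the numerator has degree at most `m (1 + deg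
    -- f) deg f = j (deg f + 1)`, exactly the allowed bound.
    refine ⟨m * f.totalDegree, ?_⟩
    have h : algebraMap _ (Localization.Away f) f * IsLocalization.Away.invSelf f = 1 :=
      IsLocalization.Away.mul_invSelf f
    have e : algebraMap _ (Localization.Away f) f ^ m =
        algebraMap _ (Localization.Away f) (f ^ (m + m * f.totalDegree)) *
          IsLocalization.Away.invSelf f ^ (m * f.totalDegree) := by
      rw [map_pow, pow_add, mul_assoc, ← mul_pow, h, one_pow, mul_one]
    rw [e]
    refine mem_growthFiltration f ((MvPolynomial.totalDegree_pow _ _).trans ?_)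
    nlinarith

end Bernstein

/-! ### The local `b`-function and the divisibility criterion -/

section LocalBFunction

variable {n : ℕ} (f : MvPolynomial (Fin n) ℂ) (p : Fin n → ℂ)

theorem algebraMap_localRing_der (i : Fin n) (a : MvPolynomial (Fin n) ℂ) :
    algebraMap _ (LocalRing p) (PartialDerivatives.der i a) =
      PartialDerivatives.der i (algebraMap _ (LocalRing p) a) :=
  (locDer_algebraMap _ _ _).symm

theorem algebraMap_localRing_injective :
    Function.Injective (algebraMap (MvPolynomial (Fin n) ℂ) (LocalRing p)) :=
  IsLocalization.injective _ (maxIdeal p).primeCompl_le_nonZeroDivisors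

/-- The base change `ℂ[x][s, 1/f] → ℂ[x]_p[s, 1/f]`. -/
def toLocal : (Localization.Away f)[X] →+*
    (Localization.Away (algebraMap _ (LocalRing p) f))[X] :=
  Polynomial.mapRingHom (awayMap (algebraMap _ (LocalRing p)) f)

/-- Lets an identity in `ℂ[x][s, 1/f] f^s` be checked after localizing at `p`. -/
theorem toLocal_injective : Function.Injective (toLocal f p) :=
  Polynomial.map_injective _ (awayMap_injective _ f (algebraMap_localRing_injective p))

theorem toLocal_C (a : MvPolynomial (Fin n) ℂ) :
    toLocal f p (C (algebraMap _ _ a)) = C (algebraMap _ _ (algebraMap _ (LocalRing p) a)) := by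
  change Polynomial.map _ _ = _
  rw [map_C, awayMap_algebraMap]

theorem toLocal_scalar (b : ℂ[X]) :
    toLocal f p (b.map (algebraMap ℂ (Localization.Away f))) = b.map (algebraMap ℂ _) := by
  change Polynomial.map _ _ = _
  rw [Polynomial.map_map]
  congr 1
  ext c
  rw [RingHom.comp_apply,
    IsScalarTower.algebraMap_apply ℂ (MvPolynomial (Fin n) ℂ) (Localization.Away f),
    awayMap_algebraMap, ← IsScalarTower.algebraMap_apply ℂ (MvPolynomial (Fin n) ℂ) (LocalRing p),
    ← IsScalarTower.algebraMap_apply]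

theorem exists_toLocal (P : (WeylAlgebra n (MvPolynomial (Fin n) ℂ))[X]) :
    ∃ Q : (WeylAlgebra n (LocalRing p))[X], ∀ u,
      toLocal f p (weylPolyAction n f P u) = weylPolyAction n _ Q (toLocal f p u) :=
  exists_baseChange f (algebraMap_localRing_der p) P

theorem FunctionalEquation.toLocal {f : MvPolynomial (Fin n) ℂ} {b : ℂ[X]}
    (h : FunctionalEquation n f b) : FunctionalEquation n (algebraMap _ (LocalRing p) f) b := by
  rw [functionalEquation_iff] at h ⊢
  obtain ⟨P, hP⟩ := h
  obtain ⟨Q, hQ⟩ := exists_toLocal f p P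
  exact ⟨Q, by rw [← toLocal_C, ← hQ, hP, toLocal_scalar]⟩

/-- This ensures that `localBFunction` is not its default value `0`, which every `s + α` would
divide. -/
theorem exists_isLocalBFunction : ∃ b, IsLocalBFunction f p b := by
  obtain ⟨b, hb, h⟩ := exists_functionalEquation f
  have hex : ∃ d, ∃ b : ℂ[X], b.natDegree = d ∧ b.Monic ∧
      FunctionalEquation n (algebraMap _ (LocalRing p) f) b :=
    ⟨_, C b.leadingCoeff⁻¹ * b, rfl, by
      rw [mul_comm]
      exact monic_mul_leadingCoeff_inv hb, (h.toLocal p).mul_left _⟩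
  classical
  obtain ⟨b', hd, hm, hb'⟩ := Nat.find_spec hex
  exact ⟨b', ⟨hm, hb'⟩, fun c hc hc' => hd ▸ Nat.find_min' hex ⟨c, rfl, hc, hc'⟩⟩

theorem isLocalBFunction_localBFunction : IsLocalBFunction f p (localBFunction f p) := by
  rw [localBFunction, dif_pos (exists_isLocalBFunction f p)]
  exact (exists_isLocalBFunction f p).choose_spec

theorem exists_clear_denominators_local (v : (Localization.Away f)[X])
    (P : (WeylAlgebra n (LocalRing p))[X]) : ∃ h ∉ maxIdeal p,
      ∃ Q : (WeylAlgebra n (MvPolynomial (Fin n) ℂ))[X],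
        toLocal f p (C (algebraMap _ _ h)) * weylPolyAction n _ P (toLocal f p v) =
          toLocal f p (weylPolyAction n f Q v) :=
  exists_clear_denominators (maxIdeal p).primeCompl f (algebraMap_localRing_der p) v P

theorem mem_maxIdeal (g : MvPolynomial (Fin n) ℂ) :
    g ∈ maxIdeal p ↔ MvPolynomial.eval p g = 0 := by
  rw [maxIdeal_eq_ker, RingHom.mem_ker]

theorem map_X_add_C (α : ℂ) {R : Type*} [Ring R] [Algebra ℂ R] :
    (X + C α : ℂ[X]).map (algebraMap ℂ R) = X + C (algebraMap ℂ R α) := by simp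

/-- Membership of a polynomial in `ann(f^s) + D[s] f + D[s] (s + α)`. -/
theorem coeff_mem_span_iff (α : ℂ) (h : MvPolynomial (Fin n) ℂ) :
    C (WeylAlgebra.coeff n _ h) ∈ annFPow n f ⊔
        Ideal.span {C (WeylAlgebra.coeff n (MvPolynomial (Fin n) ℂ) f),
          X + C (algebraMap ℂ (WeylAlgebra n (MvPolynomial (Fin n) ℂ)) α)} ↔
      ∃ B B' : (WeylAlgebra n (MvPolynomial (Fin n) ℂ))[X],
        C (algebraMap _ (Localization.Away f) h) =
          weylPolyAction n f B (C (algebraMap _ _ f)) +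
            weylPolyAction n f B' ((X + C α : ℂ[X]).map (algebraMap ℂ _)) := by
  rw [Submodule.mem_sup]
  have hact : ∀ B B' : (WeylAlgebra n (MvPolynomial (Fin n) ℂ))[X],
      weylPolyAction n f (B * C (WeylAlgebra.coeff n (MvPolynomial (Fin n) ℂ) f) +
        B' * (X + C (algebraMap ℂ (WeylAlgebra n (MvPolynomial (Fin n) ℂ)) α))) 1 =
      weylPolyAction n f B (C (algebraMap _ _ f)) +
        weylPolyAction n f B' ((X + C α : ℂ[X]).map (algebraMap ℂ _)) := by
    intro B B'
    rw [weylPolyAction_add, weylPolyAction_mul, weylPolyAction_mul, weylPolyAction_coeff,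
      ← map_X_add_C, weylPolyAction_scalar, mul_one, mul_one]
  have hh : weylPolyAction n f (C (WeylAlgebra.coeff n _ h)) 1 =
      C (algebraMap _ (Localization.Away f) h) := by
    rw [weylPolyAction_coeff, mul_one]
  constructor
  · rintro ⟨P, hP, Q, hQ, e⟩
    obtain ⟨B, B', rfl⟩ := Ideal.mem_span_pair.mp hQ
    refine ⟨B, B', ?_⟩
    rw [← hh, ← hact, ← e, weylPolyAction_add, (mem_annFPow f P).mp hP, zero_add]
  · rintro ⟨B, B', e⟩
    refine ⟨_ - _, ?_, _, Ideal.mem_span_pair.mpr ⟨B, B', rfl⟩, sub_add_cancel _ _⟩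
    rw [mem_annFPow, weylPolyAction_sub, hact, hh, e, sub_self]

variable {f}

/-- `s + α` does not divide the local `b`-function at `p` if and only if
`ann(f^s) + D[s] f + D[s] (s + α)` contains a polynomial which does not vanish at `p`. -/
theorem not_dvd_iff {b : ℂ[X]} (hb : IsLocalBFunction f p b) (α : ℂ) :
    ¬ (X + C α ∣ b) ↔ ∃ h ∉ maxIdeal p, ∃ B B' : (WeylAlgebra n (MvPolynomial (Fin n) ℂ))[X],
        C (algebraMap _ (Localization.Away f) h) =
          weylPolyAction n f B (C (algebraMap _ _ f)) +
            weylPolyAction n f B' ((X + C α : ℂ[X]).map (algebraMap ℂ _)) := by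
  have hirr : Irreducible (X + C α : ℂ[X]) := by
    have := irreducible_X_sub_C (-α)
    rwa [map_neg, sub_neg_eq_add] at this
  have hmonic : (X + C α : ℂ[X]).Monic := monic_X_add_C α
  obtain ⟨⟨hbm, hbf⟩, hmin⟩ := hb
  obtain ⟨P, hP⟩ := (functionalEquation_iff _ _).mp hbf
  constructor
  · intro hdvd
    -- Bézout: `v (s + α) + u b = 1`.
    obtain ⟨v, u, huv⟩ := (hirr.coprime_iff_not_dvd.mpr hdvd)
    obtain ⟨h, hh, Q, hQ⟩ := exists_clear_denominators_local f p (C (algebraMap _ _ f))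
      (u.map (algebraMap ℂ _) * P)
    refine ⟨h, hh, Q, C (WeylAlgebra.coeff n _ h) * v.map (algebraMap ℂ _), ?_⟩
    apply toLocal_injective f p
    rw [map_add, ← hQ, toLocal_C f p f, weylPolyAction_mul, hP, weylPolyAction_scalar,
      weylPolyAction_mul, weylPolyAction_scalar, weylPolyAction_coeff, map_mul (toLocal f p),
      map_mul (toLocal f p), toLocal_scalar, toLocal_scalar, ← mul_add, ← Polynomial.map_mul,
      ← Polynomial.map_mul, ← Polynomial.map_add, add_comm, huv, Polynomial.map_one, mul_one]
  · rintro ⟨h, hh, B, B', e⟩ ⟨c, rfl⟩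
    have hcm : c.Monic := hmonic.of_mul_monic_left hbm
    obtain ⟨Q, hQ⟩ := exists_toLocal f p B
    obtain ⟨Q', hQ'⟩ := exists_toLocal f p B'
    have hu := IsLocalization.map_units (LocalRing p)
      (⟨h, hh⟩ : (maxIdeal p).primeCompl)
    -- `k = 1 / h` in the local ring, since `h(p) ≠ 0`.
    obtain ⟨k, hk⟩ := hu.exists_left_inv
    have e₁ := congrArg (toLocal f p) e
    rw [map_add, hQ, hQ', toLocal_C, toLocal_C, toLocal_scalar] at e₁
    have hfe : FunctionalEquation n (algebraMap _ (LocalRing p) f) c := by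
      rw [functionalEquation_iff]
      -- Multiplying `h f^s = Q f·f^s + Q' (s + α) f^s` by `c` and using `c (s + α) f^s = P f·f^s`
      -- gives `h c f^s = (c Q + Q' P) f·f^s`.
      refine ⟨c.map (algebraMap ℂ _) * C (WeylAlgebra.coeff n _ k) * Q +
        C (WeylAlgebra.coeff n _ k) * Q' * P, ?_⟩
      rw [weylPolyAction_add, weylPolyAction_mul, weylPolyAction_mul, weylPolyAction_mul,
        weylPolyAction_mul, hP, mul_comm (X + C α) c, Polynomial.map_mul,
        weylPolyAction_scalar_mul, weylPolyAction_scalar_mul, weylPolyAction_scalar, ← mul_add,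
        weylPolyAction_coeff, weylPolyAction_coeff, ← mul_add,
        ← e₁, ← C_mul, ← map_mul, hk, map_one, C_1, mul_one]
    have hd := hmin c hcm hfe
    rw [hmonic.natDegree_mul hcm, natDegree_X_add_C] at hd
    omega

end LocalBFunction
end BSato

end

theorem proposition2p10 (n : ℕ) (f : MvPolynomial (Fin n) ℂ) (hf : f ≠ 0)
    (k : ℕ) (P : Fin k → (BSato.WeylAlgebra n (MvPolynomial (Fin n) ℂ))[X])
    (hP : Ideal.span (Set.range P) = BSato.annFPow n f)
    (α : ℂ) (p : Fin n → ℂ)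
    (I : Ideal (BSato.WeylAlgebra n (MvPolynomial (Fin n) ℂ))[X])
    (hI : I = Ideal.span (Set.range P ∪
      {C (BSato.WeylAlgebra.coeff n (MvPolynomial (Fin n) ℂ) f),
        X + C (algebraMap ℂ (BSato.WeylAlgebra n (MvPolynomial (Fin n) ℂ)) α)})) :
    X + C α ∣ BSato.localBFunction f p ↔
      p ∈ MvPolynomial.zeroLocus ℂ
        (I.comap (C.comp (BSato.WeylAlgebra.coeff n (MvPolynomial (Fin n) ℂ)))) := by
  -- After negation both sides assert the existence of a polynomial `h` with `h(p) ≠ 0`, so they can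
  -- be compared for each `h` separately.
  rw [← not_iff_not, BSato.not_dvd_iff p (BSato.isLocalBFunction_localBFunction f p) α,
    MvPolynomial.mem_zeroLocus_iff]
  push Not
  refine exists_congr fun h => ?_
  rw [Ideal.mem_comap, hI, Ideal.span_union, hP, RingHom.comp_apply, BSato.coeff_mem_span_iff,
    BSato.mem_maxIdeal, MvPolynomial.aeval_eq_eval, and_comm]
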